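/- Identify a pure $2\times M\times N$ state with a pair $(\Gamma_1,\Gamma_2)$ of complex $M\times N$ matrices. Two pairs are SLOCC-equivalent if one is obtained from the other by invertible local operators $T\otimes P\otimes Q$, that is, $\Gamma_i'=\sum_{j=1,2}t_{ij}\,P\Gamma_jQ$ $(i=1,2)$ with $T=(t_{ij})\in GL_2(\mathbb C)$, $P\in GL_M(\mathbb C)$, $Q\in GL_N(\mathbb C)$. Let $C_{M,l}$ be the set of pairs for which the maximum of $\operatorname{rank}(\alpha\Gamma_1+\beta\Gamma_2)$ over $(\alpha,\beta)\neq(0,0)$ is $M$ and the minimum is $l$. Let $c_{M,l}\subseteq C_{M,l}$ be the subset of pairs in normal form $$\Gamma_1=\begin{pmatrix}E&0\\0&E_1\end{pmatrix},\qquad \Gamma_2=\begin{pmatrix}J&0\\0&E_2\end{pmatrix},$$ where $E$ is an identity matrix, $J$ is a (possibly empty) matrix in Jordan form of the same size as $E$, and, for some integers $r_0\ge r_1\ge\dots\ge r_k\ge 1$ ($k\ge 0$, where $r_0=N-M\ge 0$ and $r_0=0$ is allowed if $k=0$), $E_2$ is the block-diagonal sum, from top left to bottom right, of an empty block with no row and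 $r_k$ columns and of the shifted identities $(0,\,E_{r_j\times r_j})$ of size $r_j\times r_{j-1}$ for $j=k,k-1,\dots,1$, while $E_1=(E,0)$ has the dimensions of $E_2$; thus $\Gamma_1=(E_{M\times M},0)$. Then $c_{M,l}$ classifies $C_{M,l}$: (i) Every pair in $C_{M,l}$ is SLOCC-equivalent to a pair $(\Gamma_1,\Gamma_2)\in c_{M,l}$, which can moreover be chosen with $\operatorname{rank}\Gamma_1=M$ and $\operatorname{rank}\Gamma_2=l$; and two pairs in $C_{M,l}$ are SLOCC-equivalent if and only if both are SLOCC-equivalent to one and the same pair in $c_{M,l}$. (ii) Two pairs in $c_{M,l}$, with blocks $(J,E_2)$ and $(J',E_2')$, are SLOCC-equivalent if and only if $E_2=E_2'$ and $J$, $J'$ are equivalent in the following sense: there is an invertible matrix $T=(t_{ij})\in GL_2(\mathbb C)$ with $t_{11}+t_{12}\lambda\neq 0$ for every eigenvalue $\lambda$ of $J$, such that the Jordan blocks of $J'$ are, up to order, those of $J$ with the same sizes and with each eigenvalue $\lambda$ replaced by $\dfrac{t_{21}+t_{22}\lambda}{t_{11}+t_{12}\lambda}$. -/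

import Mathlib

open Matrix

/-- The coefficients of a pure `2 × M × N` state, as a pair `(Γ 0, Γ 1)` of complex
`M × N` matrices. -/
abbrev MatrixPair (M N : ℕ) : Type := Fin 2 → Matrix (Fin M) (Fin N) ℂ

/-- The action of the local operators `T ⊗ P ⊗ Q` on a matrix pair:
`(Γ₁, Γ₂) ↦ (t₁₁ P Γ₁ Q + t₁₂ P Γ₂ Q, t₂₁ P Γ₁ Q + t₂₂ P Γ₂ Q)`. -/
noncomputable def localAction {M N : ℕ} (T : Matrix (Fin 2) (Fin 2) ℂ)
    (P : Matrix (Fin M) (Fin M) ℂ) (Q : Matrix (Fin N) (Fin N) ℂ) (Γ : MatrixPair M N) :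
    MatrixPair M N :=
  fun i => T i 0 • (P * Γ 0 * Q) + T i 1 • (P * Γ 1 * Q)

/-- SLOCC equivalence: `Δ` is the image of `Γ` under invertible local operators. -/
def SLOCCEquiv {M N : ℕ} (Γ Δ : MatrixPair M N) : Prop :=
  ∃ (T : GL (Fin 2) ℂ) (P : GL (Fin M) ℂ) (Q : GL (Fin N) ℂ),
    Δ = localAction (T : Matrix (Fin 2) (Fin 2) ℂ) (P : Matrix (Fin M) (Fin M) ℂ)
      (Q : Matrix (Fin N) (Fin N) ℂ) Γ

/-- The ranks taken by `α Γ₁ + β Γ₂` for `(α, β) ≠ (0, 0)`. -/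
def pencilRanks {M N : ℕ} (Γ : MatrixPair M N) : Set ℕ :=
  {r | ∃ α β : ℂ, (α, β) ≠ (0, 0) ∧ (α • Γ 0 + β • Γ 1).rank = r}

/-- The set `C_{n,l}` of `2 × M × N` matrix pairs whose pencil has maximal rank `n` and
minimal rank `l`. -/
def rankClass (M N n l : ℕ) : Set (MatrixPair M N) :=
  {Γ | IsGreatest (pencilRanks Γ) n ∧ IsLeast (pencilRanks Γ) l}

/-- Block-diagonal sum of two rectangular matrices. -/
def diagSum {m n m' n' : ℕ} (A : Matrix (Fin m) (Fin n) ℂ) (B : Matrix (Fin m') (Fin n') ℂ) :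
    Matrix (Fin (m + m')) (Fin (n + n')) ℂ :=
  Matrix.reindex finSumFinEquiv finSumFinEquiv (Matrix.fromBlocks A 0 0 B)

/-- The `n × n` upper Jordan block with eigenvalue `z`. -/
def jordanBlock (n : ℕ) (z : ℂ) : Matrix (Fin n) (Fin n) ℂ :=
  Matrix.of fun i j => if i = j then z else if (j : ℕ) = (i : ℕ) + 1 then 1 else 0

/-- The size of the Jordan matrix with the given list of blocks (size, eigenvalue). -/
def jordanSize : List (ℕ × ℂ) → ℕ
  | [] => 0
  | b :: L => b.1 + jordanSize L

/-- The Jordan matrix with the given list of blocks (size, eigenvalue) along the diagonal. -/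
def jordanMatrix : (L : List (ℕ × ℂ)) → Matrix (Fin (jordanSize L)) (Fin (jordanSize L)) ℂ
  | [] => 0
  | b :: L => diagSum (jordanBlock b.1 b.2) (jordanMatrix L)

/-- The `r × c` matrix `(0, E_{r × r})`, an identity matrix pushed to the right. -/
def rightIdentity (r c : ℕ) : Matrix (Fin r) (Fin c) ℂ :=
  Matrix.of fun i j => if (j : ℕ) + r = (i : ℕ) + c then 1 else 0

/-- The number of rows `r_k + ⋯ + r_1` of the staircase with steps `[r_1, …, r_k]`. -/
def stairRows : List ℕ → ℕ
  | [] => 0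
  | r :: L => stairRows L + r

/-- The block `E₂` of shifted identities: for steps `[r_1, …, r_k]` and base width `r_0` it is
the block-diagonal sum, from top left to bottom right, of an empty block with no row and `r_k`
columns and of the blocks `(0, E_{r_j × r_j})` with `r_j` rows and `r_{j-1}` columns,
for `j = k, …, 1`. -/
def stairMatrix : (r₀ : ℕ) → (L : List ℕ) → Matrix (Fin (stairRows L)) (Fin (stairRows L + r₀)) ℂ
  | _, [] => 0
  | r₀, r :: L => diagSum (stairMatrix r L) (rightIdentity r r₀)

/-- The block `E₁ = (E, 0)`, with the dimensions of `E₂`. -/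
def stairIdentity (r₀ : ℕ) (L : List ℕ) : Matrix (Fin (stairRows L)) (Fin (stairRows L + r₀)) ℂ :=
  Matrix.of fun i j => if (i : ℕ) = (j : ℕ) then 1 else 0

/-- The discrete data of a normal form: the Jordan blocks of `J`, and the base width `r₀` and
the steps `r₀ ≥ r_1 ≥ ⋯ ≥ r_k ≥ 1` of the block `E₂`. -/
structure NormalFormData where
  blocks : List (ℕ × ℂ)
  base : ℕ
  steps : List ℕ
  blocks_pos : ∀ b ∈ blocks, 0 < b.1
  steps_pos : ∀ r ∈ steps, 0 < r
  steps_desc : (base :: steps).IsChain (· ≥ ·)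

namespace NormalFormData

/-- Number of rows of the normal form. -/
def rows (d : NormalFormData) : ℕ := jordanSize d.blocks + stairRows d.steps

/-- Number of columns of the normal form. -/
def cols (d : NormalFormData) : ℕ := jordanSize d.blocks + (stairRows d.steps + d.base)

/-- The normal form `Γ₁ = diag(E, E₁)`, `Γ₂ = diag(J, E₂)`. -/
def pair (d : NormalFormData) : MatrixPair d.rows d.cols :=
  ![diagSum (1 : Matrix (Fin (jordanSize d.blocks)) (Fin (jordanSize d.blocks)) ℂ)
      (stairIdentity d.base d.steps),
    diagSum (jordanMatrix d.blocks) (stairMatrix d.base d.steps)]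

/-- `Γ` is the `M × N` matrix pair in normal form with data `d`; in particular the dimensions
given by `d` are `M` and `N`. -/
def Represents (d : NormalFormData) {M N : ℕ} (Γ : MatrixPair M N) : Prop :=
  ∃ (hM : d.rows = M) (hN : d.cols = N),
    ∀ i, Γ i = Matrix.reindex (finCongr hM) (finCongr hN) (d.pair i)

end NormalFormData

/-- The set `c_{M,l} ⊆ C_{M,l}` of the pairs in `C_{M,l}` that are in normal form. -/
def normalFormSet (M N l : ℕ) : Set (MatrixPair M N) :=
  {Γ | Γ ∈ rankClass M N M l ∧ ∃ d : NormalFormData, d.Represents Γ}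

/-- Equivalence of Jordan forms `J`, `J'`, given by their blocks: an invertible `2 × 2` matrix
`T` acts on the eigenvalues by `z ↦ (t₂₁ + t₂₂ z) / (t₁₁ + t₁₂ z)`, without poles at the
eigenvalues of `J`, and the blocks of `J'` are, up to order, those of `J` with the
eigenvalues so transformed and the sizes unchanged. -/
def JordanEquiv (b b' : List (ℕ × ℂ)) : Prop :=
  ∃ T : GL (Fin 2) ℂ,
    (∀ x ∈ b, T.val 0 0 + T.val 0 1 * x.2 ≠ 0) ∧
    (b.map fun x =>
      (x.1, (T.val 1 0 + T.val 1 1 * x.2) / (T.val 0 0 + T.val 0 1 * x.2))).Perm b'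

/-! The theorem is the Kronecker classification of pencils of full row rank, refined by the action
of GL₂ on the pencil parameter. A suitable T makes the first matrix a surjection f; the other matrix
is a map g with the same source and target.

Existence of the normal form is an induction on the dimension of the target
(`exists_isKroneckerBasis`). If g kills ker f, then g = h ∘ f and a Jordan basis of h suffices.
Otherwise one passes to V / ker f → W / g(ker f); a normal form there lifts, and ker f → g(ker f)
contributes one more step of the staircase.

Uniqueness rests on two invariants which T merely reparametrises. For n distinct generic values μ,
the sum of the spaces ker(f - μ g) has dimension r₀ + ⋯ + r_{n-1}
(`KroneckerCoords.finrank_iSup_ker`), which recovers the staircase. For the Jordan part, the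
relation h ∘ f⁻¹, with f and h combinations of the pair, is iterated on the whole target: a nonzero
combination of E₁ and E₂ is always surjective, so only nullities of powers of α + βJ show up as
codimensions (`KroneckerCoords.finrank_imageIter`), and these count the Jordan blocks. Comparing
them before and after T gives the Möbius action on eigenvalues (`KroneckerCoords.blocks_perm`).

The converse in (ii) needs no Jordan form of a Möbius transform of J: the transformed pair has some
normal form, and the necessary conditions already identify it up to the order of the blocks. -/

/-! ### Jordan bases -/

theorem diagSum_apply {m n m' n' : ℕ} (A : Matrix (Fin m) (Fin n) ℂ)
    (B : Matrix (Fin m') (Fin n') ℂ) (i : Fin m ⊕ Fin m') (j : Fin n ⊕ Fin n') :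
    diagSum A B (finSumFinEquiv i) (finSumFinEquiv j) = Matrix.fromBlocks A 0 0 B i j := by
  simp [diagSum]

/-- The (i, j) entry is φ(N^(m-1+i-j) v), which vanishes below the diagonal because N^m v = 0, and
is the nonzero number φ(N^(m-1) v) on it. This makes the chain of v dual to the functionals φ ∘ N^i.
-/
theorem isUnit_hankelChain {W : Type*} [AddCommGroup W] [Module ℂ W]
    (N : Module.End ℂ W) (φ : Module.Dual ℂ W) (m : ℕ) (v : W) (hv : (N ^ m) v = 0)
    (hφ : φ ((N ^ (m - 1)) v) ≠ 0) :
    IsUnit (Matrix.of fun i j : Fin m => φ ((N ^ (i : ℕ)) ((N ^ (m - 1 - (j : ℕ))) v))) := by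
  rw [Matrix.isUnit_iff_isUnit_det, isUnit_iff_ne_zero, Matrix.det_of_isUpperTriangular]
  · refine Finset.prod_ne_zero_iff.2 fun i _ => ?_
    have : (i : ℕ) + (m - 1 - i) = m - 1 := by omega
    simpa only [Matrix.of_apply, ← Module.End.mul_apply, ← pow_add, this] using hφ
  · intro i j hij
    have hij : (j : ℕ) < i := hij
    have : (i : ℕ) + (m - 1 - j) = ((i : ℕ) - 1 - j) + m := by omega
    simp only [Matrix.of_apply, ← Module.End.mul_apply, ← pow_add, this]
    rw [pow_add, Module.End.mul_apply, hv]
    simp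

/-- The length m is the point where the kernels of the powers of N stabilise, so the chain is a
longest one. That is what allows a functional φ that vanishes on the range of N^m and not on the end
of the chain; it later yields an invariant complement. -/
theorem exists_maximal_chain {W : Type*} [AddCommGroup W] [Module ℂ W] [FiniteDimensional ℂ W]
    (N : Module.End ℂ W) (hN : LinearMap.ker N ≠ ⊥) :
    ∃ (m : ℕ) (v : W) (φ : Module.Dual ℂ W), 0 < m ∧ (N ^ m) v = 0 ∧ φ ((N ^ (m - 1)) v) ≠ 0 ∧
      ∀ x, φ ((N ^ m) x) = 0 := by
  have hex : ∃ m : ℕ, LinearMap.ker (N ^ m) = LinearMap.ker (N ^ (m + 1)) :=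
    ⟨Module.finrank ℂ W, (Module.End.ker_pow_eq_ker_pow_finrank_of_le (Nat.le_succ _)).symm⟩
  classical
  obtain ⟨m, hm, hmin⟩ : ∃ m : ℕ, LinearMap.ker (N ^ m) = LinearMap.ker (N ^ (m + 1)) ∧
      ∀ k < m, LinearMap.ker (N ^ k) ≠ LinearMap.ker (N ^ (k + 1)) :=
    ⟨Nat.find hex, Nat.find_spec hex, fun k hk => Nat.find_min hex hk⟩
  have hpos : 0 < m := by
    rcases Nat.eq_zero_or_pos m with rfl | h
    · exact absurd (by simpa [LinearMap.ker_id, Module.End.one_eq_id] using hm.symm) hN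
    · exact h
  obtain ⟨k, rfl⟩ : ∃ k, m = k + 1 := ⟨m - 1, by omega⟩
  have hle : LinearMap.ker (N ^ k) ≤ LinearMap.ker (N ^ (k + 1)) := by
    intro x hx
    rw [LinearMap.mem_ker] at hx ⊢
    rw [pow_succ', Module.End.mul_apply, hx, map_zero]
  obtain ⟨v, hv, hv'⟩ := SetLike.exists_of_lt (lt_of_le_of_ne hle (hmin k (by omega)))
  rw [LinearMap.mem_ker] at hv hv'
  -- If N^k v = N^(k+1) u, then u is killed by N^(k+2), hence already by N^(k+1), so N^k v = 0.
  have hnot : (N ^ k) v ∉ LinearMap.range (N ^ (k + 1)) := by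
    rintro ⟨u, hu⟩
    have : u ∈ LinearMap.ker (N ^ (k + 1)) := by
      rw [hm, LinearMap.mem_ker, pow_succ', Module.End.mul_apply, hu, ← Module.End.mul_apply,
        ← pow_succ', hv]
    exact hv' (hu ▸ this)
  obtain ⟨φ, hφ, hle⟩ := Submodule.exists_le_ker_of_notMem hnot
  exact ⟨k + 1, v, φ, hpos, hv, by simpa using hφ, fun x => hle ⟨x, rfl⟩⟩

/-- Every endomorphism of a finite-dimensional complex space has a Jordan basis. -/
theorem exists_jordanBasis {W : Type*} [AddCommGroup W] [Module ℂ W] [FiniteDimensional ℂ W]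
    (h : Module.End ℂ W) :
    ∃ (b : List (ℕ × ℂ)) (w : Module.Basis (Fin (jordanSize b)) ℂ W), (∀ x ∈ b, 0 < x.1) ∧
      ∀ j, h (w j) = ∑ i, jordanMatrix b i j • w i := by
  induction hn : Module.finrank ℂ W using Nat.strong_induction_on generalizing W with
  | _ n ih =>
  rcases subsingleton_or_nontrivial W with hW | hW
  · have : IsEmpty (Fin (jordanSize [])) := inferInstanceAs (IsEmpty (Fin 0))
    exact ⟨[], Module.Basis.empty W, by simp, fun j => isEmptyElim j⟩
  obtain ⟨z, hz⟩ := Module.End.exists_eigenvalue h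
  set N : Module.End ℂ W := h - algebraMap ℂ (Module.End ℂ W) z with hNdef
  have hhN : ∀ x, h x = z • x + N x := by
    intro x; simp [hNdef, Module.algebraMap_end_apply]
  have hN : LinearMap.ker N ≠ ⊥ := by
    have := hz
    rwa [Module.End.hasEigenvalue_iff, Module.End.eigenspace_def] at this
  obtain ⟨m, v, φ, hm, hv, hφ, hφN⟩ := exists_maximal_chain N hN
  let Ψ : W →ₗ[ℂ] (Fin m → ℂ) := LinearMap.pi fun i => φ ∘ₗ (N ^ (i : ℕ))
  -- The chain is listed from its end, so that N maps each vector to the preceding one and the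
  -- Jordan block is upper triangular.
  let u : Fin m → W := fun j => (N ^ (m - 1 - (j : ℕ))) v
  let c : (Fin m → ℂ) →ₗ[ℂ] W := Fintype.linearCombination ℂ u
  have hU := isUnit_hankelChain N φ m v hv hφ
  set H := Matrix.of fun i j : Fin m => φ ((N ^ (i : ℕ)) ((N ^ (m - 1 - (j : ℕ))) v)) with hH
  have hΨc : ∀ a, Ψ (c a) = H *ᵥ a := by
    intro a
    ext i
    simp [Ψ, c, Fintype.linearCombination_apply, Matrix.mulVec, dotProduct, hH, u, mul_comm]
  have hinj := Matrix.mulVec_injective_iff_isUnit.2 hU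
  have hsurj := Matrix.mulVec_surjective_iff_isUnit.2 hU
  -- Since Ψ restricts to an isomorphism on the span of the chain, ker Ψ is a complement of that
  -- span.
  let e₀ : ((Fin m → ℂ) × LinearMap.ker Ψ) →ₗ[ℂ] W := c.coprod (LinearMap.ker Ψ).subtype
  have he₀ : Function.Bijective e₀ := by
    constructor
    · rw [← LinearMap.ker_eq_bot, LinearMap.ker_eq_bot']
      rintro ⟨a, x, hx⟩ hax
      have h1 : c a + x = 0 := by simpa [e₀] using hax
      have h2 : Ψ (c a + x) = 0 := by rw [h1, map_zero]
      rw [map_add, LinearMap.mem_ker.1 hx, add_zero, hΨc] at h2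
      have ha : a = 0 := hinj (by simpa using h2)
      subst ha
      have : x = 0 := by simpa using h1
      subst this
      rfl
    · intro y
      obtain ⟨a, ha⟩ := hsurj (Ψ y)
      refine ⟨(a, ⟨y - c a, ?_⟩), by simp [e₀]⟩
      rw [LinearMap.mem_ker, map_sub, hΨc]
      simp [← ha]
  let e := LinearEquiv.ofBijective e₀ he₀
  -- The coordinates of Ψ (N x) are those of Ψ x shifted by one, and the new last one, φ(N^m x), is
  -- zero by the choice of φ.
  have hinv : ∀ x ∈ LinearMap.ker Ψ, h x ∈ LinearMap.ker Ψ := by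
    intro x hx
    have hx' : ∀ i : ℕ, i ≤ m → φ ((N ^ i) x) = 0 := by
      intro i hi
      rcases hi.lt_or_eq with hi | rfl
      · exact congrFun (LinearMap.mem_ker.1 hx) ⟨i, hi⟩
      · exact hφN x
    rw [hhN]
    refine add_mem (Submodule.smul_mem _ _ hx) ?_
    rw [LinearMap.mem_ker]
    ext i
    have := hx' (i + 1) (by omega)
    rw [pow_succ, Module.End.mul_apply] at this
    simpa [Ψ] using this
  have hdim : Module.finrank ℂ (LinearMap.ker Ψ) < n := by
    have := e.finrank_eq
    rw [Module.finrank_prod, Module.finrank_fin_fun, hn] at this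
    omega
  obtain ⟨b, w, hb, hw⟩ := ih _ hdim (h.restrict hinv) rfl
  let B : Module.Basis (Fin m ⊕ Fin (jordanSize b)) ℂ W :=
    ((Pi.basisFun ℂ (Fin m)).prod w).map e
  have hBl : ∀ i, B (Sum.inl i) = u i := by
    intro i
    simp [B, e, e₀, c]
  have hBr : ∀ i, B (Sum.inr i) = w i := by
    intro i
    simp [B, e, e₀]
  have hB : ∀ j, h (B j) = ∑ i, Matrix.fromBlocks (jordanBlock m z) 0 0 (jordanMatrix b) i j • B i := by
    intro j
    rcases j with j | j
    · simp only [Fintype.sum_sum_type, Matrix.fromBlocks_apply₁₁, Matrix.fromBlocks_apply₂₁,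
        Matrix.zero_apply, zero_smul, Finset.sum_const_zero, add_zero, hBl, hhN, jordanBlock, Matrix.of_apply]
      rcases Nat.eq_zero_or_pos (j : ℕ) with hj | hj
      · rw [Finset.sum_eq_single j]
        · have : N (u j) = 0 := by
            rw [← hv]
            simp only [u, ← Module.End.mul_apply, ← pow_succ']
            rw [hj]; congr 2; omega
          simp [this]
        · intro i _ hij
          have : ¬ ((j : ℕ) = i + 1) := by omega
          simp [hij, this]
        · simp
      · let j' : Fin m := ⟨j - 1, by omega⟩
        have hne : j ≠ j' := by intro h; have := congrArg Fin.val h; simp [j'] at this; omega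
        rw [Finset.sum_eq_add j j' hne]
        · have hj' : (j : ℕ) = j' + 1 := by simp [j']; omega
          have : N (u j) = u j' := by
            simp only [u, ← Module.End.mul_apply, ← pow_succ', j']
            congr 2; omega
          rw [this, if_pos rfl, if_neg hne.symm, if_pos hj', one_smul]
        · intro i _ hij
          have h2 : ¬ ((j : ℕ) = i + 1) := by
            intro h; apply hij.2; ext; simp [j']; omega
          simp [hij.1, h2]
        · simp
        · simp
    · simp only [Fintype.sum_sum_type, Matrix.fromBlocks_apply₁₂, Matrix.fromBlocks_apply₂₂,
        Matrix.zero_apply, zero_smul, Finset.sum_const_zero, zero_add, hBr]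
      have := congrArg Subtype.val (hw j)
      simpa using this
  let B' : Module.Basis (Fin (jordanSize ((m, z) :: b))) ℂ W := B.reindex finSumFinEquiv
  have hB' : ∀ i : Fin m ⊕ Fin (jordanSize b), B' (finSumFinEquiv i : Fin (m + jordanSize b)) = B i := by
    intro i
    exact (B.reindex_apply finSumFinEquiv _).trans (by rw [Equiv.symm_apply_apply])
  refine ⟨(m, z) :: b, B', ?_, ?_⟩
  · rintro x (_ | ⟨_, hx⟩)
    · exact hm
    · exact hb x hx
  · intro j
    obtain ⟨j, rfl⟩ := (finSumFinEquiv (m := m) (n := jordanSize b)).surjective j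
    rw [hB' j, hB j]
    refine Eq.trans (Finset.sum_congr rfl fun i _ => ?_) (Equiv.sum_comp finSumFinEquiv
      fun i : Fin (m + jordanSize b) => jordanMatrix ((m, z) :: b) i (finSumFinEquiv j) • B' i)
    rw [hB' i]
    exact congrArg (· • B i) (diagSum_apply (jordanBlock m z) (jordanMatrix b) i j).symm

/-! ### Entries of block-diagonal sums -/

section diagSum

variable {m n m' n' : ℕ} (A : Matrix (Fin m) (Fin n) ℂ) (B : Matrix (Fin m') (Fin n') ℂ)

@[simp] theorem diagSum_castAdd_castAdd (i : Fin m) (j : Fin n) :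
    diagSum A B (Fin.castAdd m' i) (Fin.castAdd n' j) = A i j :=
  diagSum_apply A B (Sum.inl i) (Sum.inl j)

@[simp] theorem diagSum_castAdd_natAdd (i : Fin m) (j : Fin n') :
    diagSum A B (Fin.castAdd m' i) (Fin.natAdd n j) = 0 :=
  diagSum_apply A B (Sum.inl i) (Sum.inr j)

@[simp] theorem diagSum_natAdd_castAdd (i : Fin m') (j : Fin n) :
    diagSum A B (Fin.natAdd m i) (Fin.castAdd n' j) = 0 :=
  diagSum_apply A B (Sum.inr i) (Sum.inl j)

@[simp] theorem diagSum_natAdd_natAdd (i : Fin m') (j : Fin n') :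
    diagSum A B (Fin.natAdd m i) (Fin.natAdd n j) = B i j :=
  diagSum_apply A B (Sum.inr i) (Sum.inr j)

end diagSum

/-! ### Existence of the Kronecker form -/

section Staircase

variable {V W : Type*} [AddCommGroup V] [Module ℂ V] [FiniteDimensional ℂ V]
  [AddCommGroup W] [Module ℂ W] [FiniteDimensional ℂ W]

omit [FiniteDimensional ℂ V] [FiniteDimensional ℂ W] in
/-- A basis of the target, lifted along a linear map, and a basis of the kernel form a basis. -/
theorem exists_basis_of_lift {ι κ : Type*} [Finite ι] [Finite κ] (f : V →ₗ[ℂ] W)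
    (w : Module.Basis ι ℂ W) (k : Module.Basis κ ℂ (LinearMap.ker f)) (v : ι → V)
    (hv : ∀ i, f (v i) = w i) :
    ∃ B : Module.Basis (ι ⊕ κ) ℂ V, (∀ i, B (Sum.inl i) = v i) ∧ ∀ c, B (Sum.inr c) = k c := by
  let s : W →ₗ[ℂ] V := w.constr ℂ v
  have hs : ∀ y, f (s y) = y := by
    intro y
    have : f ∘ₗ s = LinearMap.id := w.ext fun i => by simp [s, hv]
    exact LinearMap.congr_fun this y
  let e₀ : (W × LinearMap.ker f) →ₗ[ℂ] V := s.coprod (LinearMap.ker f).subtype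
  have he₀ : Function.Bijective e₀ := by
    constructor
    · rw [← LinearMap.ker_eq_bot, LinearMap.ker_eq_bot']
      rintro ⟨y, x, hx⟩ hax
      have h1 : s y + x = 0 := by simpa [e₀] using hax
      have h2 : f (s y + x) = 0 := by rw [h1, map_zero]
      rw [map_add, LinearMap.mem_ker.1 hx, add_zero, hs] at h2
      subst h2
      have : x = 0 := by simpa using h1
      subst this
      rfl
    · intro x
      refine ⟨(f x, ⟨x - s (f x), ?_⟩), by simp [e₀]⟩
      rw [LinearMap.mem_ker, map_sub, hs, sub_self]
  let e := LinearEquiv.ofBijective e₀ he₀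
  exact ⟨(w.prod k).map e, fun i => by simp [e, e₀, s], fun c => by simp [e, e₀]⟩

omit [FiniteDimensional ℂ V] [FiniteDimensional ℂ W] in
theorem exists_basis_of_lift_fin {a n r : ℕ} (f : V →ₗ[ℂ] W)
    (w : Module.Basis (Fin a ⊕ Fin n) ℂ W) (k : Module.Basis (Fin r) ℂ (LinearMap.ker f))
    (v : Fin a ⊕ Fin n → V) (hv : ∀ i, f (v i) = w i) :
    ∃ B : Module.Basis (Fin a ⊕ Fin (n + r)) ℂ V, (∀ i, B (Sum.inl i) = v (Sum.inl i)) ∧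
      (∀ i, B (Sum.inr (Fin.castAdd r i)) = v (Sum.inr i)) ∧
      ∀ c, B (Sum.inr (Fin.natAdd n c)) = k c := by
  obtain ⟨B, hl, hr⟩ := exists_basis_of_lift f w k v hv
  let e : (Fin a ⊕ Fin n) ⊕ Fin r ≃ Fin a ⊕ Fin (n + r) :=
    (Equiv.sumAssoc _ _ _).trans (Equiv.sumCongr (Equiv.refl _) finSumFinEquiv)
  refine ⟨B.reindex e, fun i => ?_, fun i => ?_, fun c => ?_⟩
  · rw [Module.Basis.reindex_apply, ← hl]
    exact congrArg B (e.symm_apply_eq.2 (by simp [e]))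
  · rw [Module.Basis.reindex_apply, ← hl]
    exact congrArg B (e.symm_apply_eq.2 (by simp [e]))
  · rw [Module.Basis.reindex_apply, ← hr]
    exact congrArg B (e.symm_apply_eq.2 (by simp [e]))

/-- The bases `v`, `w` put the pair `f`, `g` of linear maps into the normal form with Jordan blocks
`b`, base width `r₀` and steps `L`. -/
structure IsKroneckerBasis (f g : V →ₗ[ℂ] W) (b : List (ℕ × ℂ)) (r₀ : ℕ) (L : List ℕ)
    (v : Module.Basis (Fin (jordanSize b) ⊕ Fin (stairRows L + r₀)) ℂ V)
    (w : Module.Basis (Fin (jordanSize b) ⊕ Fin (stairRows L)) ℂ W) : Prop where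
  blocks_pos : ∀ x ∈ b, 0 < x.1
  steps_pos : ∀ r ∈ L, 0 < r
  steps_desc : (r₀ :: L).IsChain (· ≥ ·)
  fst_inl : ∀ i, f (v (Sum.inl i)) = w (Sum.inl i)
  fst_castAdd : ∀ i, f (v (Sum.inr (Fin.castAdd r₀ i))) = w (Sum.inr i)
  fst_natAdd : ∀ c, f (v (Sum.inr (Fin.natAdd _ c))) = 0
  snd_inl : ∀ j, g (v (Sum.inl j)) = ∑ i, jordanMatrix b i j • w (Sum.inl i)
  snd_inr : ∀ j, g (v (Sum.inr j)) = ∑ i, stairMatrix r₀ L i j • w (Sum.inr i)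

/-- Here g factors as h ∘ f. A Jordan basis of h, lifted along f, gives the block J; ker f gives
zero columns, so the staircase has no step and base width dim ker f. -/
theorem exists_isKroneckerBasis_of_ker_le (f g : V →ₗ[ℂ] W) (hf : Function.Surjective f)
    (hfg : LinearMap.ker f ≤ LinearMap.ker g) :
    ∃ b r₀ L v w, IsKroneckerBasis f g b r₀ L v w := by
  let h : W →ₗ[ℂ] W := (LinearMap.ker f).liftQ g hfg ∘ₗ
    (f.quotKerEquivOfSurjective hf).symm.toLinearMap
  have hh : ∀ x, h (f x) = g x := by
    intro x
    have : (f.quotKerEquivOfSurjective hf).symm (f x) = Submodule.Quotient.mk x := by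
      rw [LinearEquiv.symm_apply_eq]; rfl
    simp [h, this]
  obtain ⟨b, w₀, hb, hw₀⟩ := exists_jordanBasis h
  have : IsEmpty (Fin (stairRows [])) := inferInstanceAs (IsEmpty (Fin 0))
  let w : Module.Basis (Fin (jordanSize b) ⊕ Fin (stairRows [])) ℂ W :=
    w₀.reindex (Equiv.sumEmpty _ _).symm
  have hw : ∀ i, w (Sum.inl i) = w₀ i := fun i => by simp [w]
  choose v hv using fun i => hf (w i)
  obtain ⟨B, h1, h2, h3⟩ := exists_basis_of_lift_fin f w
    (Module.finBasis ℂ (LinearMap.ker f)) v hv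
  have hker : ∀ c, B (Sum.inr (Fin.natAdd _ c)) ∈ LinearMap.ker f := fun c => by
    rw [h3]; exact Subtype.property _
  refine ⟨b, _, [], B, w, hb, by simp, List.isChain_singleton _, fun i => by rw [h1, hv],
    fun i => isEmptyElim i, hker, fun j => ?_, fun j => ?_⟩
  · rw [← hh, h1, hv, hw, hw₀]
    simp only [hw]
  · rw [Finset.univ_eq_empty, Finset.sum_empty]
    refine Fin.addCases (fun i => isEmptyElim i) (fun c => ?_) j
    exact hfg (hker c)

omit [FiniteDimensional ℂ W] in
/-- A basis of the source adapted to a surjection onto a space with a given basis: the last vectors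
lift that basis, and the first ones span the kernel. -/
theorem exists_rightIdentity_basis {r : ℕ} (γ : V →ₗ[ℂ] W) (w : Module.Basis (Fin r) ℂ W)
    (hγ : Function.Surjective γ) :
    ∃ (s : ℕ) (k : Module.Basis (Fin (s + r)) ℂ V),
      ∀ c, γ (k c) = ∑ i, rightIdentity r (s + r) i c • w i := by
  choose v hv using fun i => hγ (w i)
  obtain ⟨B, hl, hr⟩ := exists_basis_of_lift γ w (Module.finBasis ℂ (LinearMap.ker γ)) v hv
  refine ⟨_, B.reindex ((Equiv.sumComm _ _).trans finSumFinEquiv), fun c => ?_⟩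
  refine Fin.addCases (fun c => ?_) (fun c => ?_) c
  · have : ∀ i : Fin r, rightIdentity r (Module.finrank ℂ (LinearMap.ker γ) + r) i
        (Fin.castAdd r c) = 0 := by
      intro i
      have := c.2
      simp only [rightIdentity, Matrix.of_apply, Fin.val_castAdd]
      rw [if_neg (by omega)]
    simp only [this, zero_smul, Finset.sum_const_zero]
    simp [hr]
  · have : ∀ i : Fin r, rightIdentity r (Module.finrank ℂ (LinearMap.ker γ) + r) i
        (Fin.natAdd _ c) = if i = c then 1 else 0 := by
      intro i
      simp only [rightIdentity, Matrix.of_apply, Fin.val_natAdd]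
      congr 1
      rw [Fin.ext_iff, eq_iff_iff]
      omega
    simp [this, hl, hv]

/-- Every pair of linear maps, the first of which is surjective, has a normal form. -/
theorem exists_isKroneckerBasis (f g : V →ₗ[ℂ] W) (hf : Function.Surjective f) :
    ∃ b r₀ L v w, IsKroneckerBasis f g b r₀ L v w := by
  induction hn : Module.finrank ℂ W using Nat.strong_induction_on generalizing V W with
  | _ n ih =>
  by_cases hfg : LinearMap.ker f ≤ LinearMap.ker g
  · exact exists_isKroneckerBasis_of_ker_le f g hf hfg
  set K := LinearMap.ker f with hK
  set G := K.map g with hG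
  have hGbot : G ≠ ⊥ := by rwa [hG, Ne, ← le_bot_iff, Submodule.map_le_iff_le_comap]
  have hGpos : 0 < Module.finrank ℂ G :=
    Nat.pos_of_ne_zero fun h => hGbot (Submodule.finrank_eq_zero.1 h)
  have hGle := Submodule.finrank_quotient_add_finrank G
  let f' : (V ⧸ K) →ₗ[ℂ] W ⧸ G := K.mapQ G f fun x hx => by
    rw [Submodule.mem_comap, LinearMap.mem_ker.1 hx]; exact zero_mem _
  let g' : (V ⧸ K) →ₗ[ℂ] W ⧸ G := K.mapQ G g (Submodule.le_comap_map g K)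
  have hf' : Function.Surjective f' := by
    intro y
    obtain ⟨y, rfl⟩ := G.mkQ_surjective y
    obtain ⟨x, rfl⟩ := hf y
    exact ⟨K.mkQ x, by simp [f']⟩
  obtain ⟨b, r, L, v', w', hB⟩ := ih _ (by omega) f' g' hf' rfl
  -- Through f the quotient V / ker f is W itself, so the source basis of the smaller problem
  -- becomes the target basis of the larger one.
  let F : (V ⧸ K) ≃ₗ[ℂ] W := f.quotKerEquivOfSurjective hf
  have hF : ∀ x : V, F (K.mkQ x) = f x := fun x => rfl
  let w : Module.Basis (Fin (jordanSize b) ⊕ Fin (stairRows L + r)) ℂ W := v'.map F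
  have hw : ∀ i, G.mkQ (w i) = f' (v' i) := by
    intro i
    obtain ⟨x, hx⟩ := K.mkQ_surjective (v' i)
    simp only [w, Module.Basis.map_apply, ← hx, hF]
    simp [f']
  -- The base width of the quotient problem is the difference of the dimensions of V / K ≃ W and W /
  -- G; it becomes the first step.
  have hr : Module.finrank ℂ G = r := by
    have h1 := Module.finrank_eq_card_basis w
    have h2 := Module.finrank_eq_card_basis w'
    simp only [Fintype.card_sum, Fintype.card_fin] at h1 h2
    omega
  have hwG : ∀ c : Fin r, w (Sum.inr (Fin.natAdd _ c)) ∈ G := by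
    intro c
    rw [← Submodule.Quotient.mk_eq_zero, ← Submodule.mkQ_apply, hw, hB.fst_natAdd]
  have hli : LinearIndependent ℂ fun c : Fin r =>
      (⟨w (Sum.inr (Fin.natAdd _ c)), hwG c⟩ : G) := by
    refine LinearIndependent.of_comp G.subtype ?_
    exact w.linearIndependent.comp (fun c : Fin r => Sum.inr (Fin.natAdd _ c))
      (Sum.inr_injective.comp (Fin.natAdd_injective _ _))
  let wG : Module.Basis (Fin r) ℂ G :=
    Module.Basis.mk hli (hli.span_eq_top_of_card_eq_finrank' (by simp [hr])).ge
  have hwGc : ∀ c, (wG c : W) = w (Sum.inr (Fin.natAdd _ c)) := by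
    intro c; simp [wG]
  let γ : K →ₗ[ℂ] G := g.submoduleMap K
  obtain ⟨s, k, hk⟩ := exists_rightIdentity_basis γ wG (g.submoduleMap_surjective K)
  -- The values that the normal form prescribes for g; the quotient problem guarantees them only
  -- modulo G.
  let t : Fin (jordanSize b) ⊕ Fin (stairRows L + r) → W :=
    Sum.elim (fun j => ∑ i, jordanMatrix b i j • w (Sum.inl i))
      fun j => ∑ i, stairMatrix r L i j • w (Sum.inr (Fin.castAdd r i))
  have ht : ∀ j, G.mkQ (t j) = g' (v' j) := by
    rintro (j | j)
    · rw [hB.snd_inl]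
      simp only [t, Sum.elim_inl, map_sum, map_smul, hw, hB.fst_inl]
    · rw [hB.snd_inr]
      simp only [t, Sum.elim_inr, map_sum, map_smul, hw, hB.fst_castAdd]
  -- The error lies in G = g(ker f), so a correction by an element of ker f removes it without
  -- changing the value of f.
  have hlift : ∀ j, ∃ x : V, f x = w j ∧ g x = t j := by
    intro j
    obtain ⟨x, hx⟩ := K.mkQ_surjective (v' j)
    have h1 : g x - t j ∈ G := by
      rw [← Submodule.Quotient.mk_eq_zero, ← Submodule.mkQ_apply, map_sub, ht, ← hx]
      simp [g']
    obtain ⟨y, hy, hgy⟩ := h1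
    refine ⟨x - y, ?_, ?_⟩
    · rw [map_sub, LinearMap.mem_ker.1 hy, sub_zero, ← hF, hx]; rfl
    · rw [map_sub, hgy]; abel
  choose v hv hgv using hlift
  obtain ⟨B, h1, h2, h3⟩ := exists_basis_of_lift_fin f w k v hv
  have hgk : ∀ c, g (k c) =
      ∑ i, rightIdentity r (s + r) i c • w (Sum.inr (Fin.natAdd _ i)) := by
    intro c
    have := congrArg Subtype.val (hk c)
    simp only [AddSubmonoidClass.coe_finsetSum, Submodule.coe_smul, hwGc] at this
    exact this
  have hl : ∀ j, g (B (Sum.inr (Fin.castAdd (s + r) j))) = ∑ i : Fin (stairRows L + r),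
      diagSum (stairMatrix r L) (rightIdentity r (s + r)) i (Fin.castAdd (s + r) j) •
        w (Sum.inr i) := by
    intro j
    rw [h2, hgv, Fin.sum_univ_add]
    simp [t]
  have hr' : ∀ c, g (B (Sum.inr (Fin.natAdd (stairRows L + r) c))) =
      ∑ i : Fin (stairRows L + r), diagSum (stairMatrix r L) (rightIdentity r (s + r)) i
        (Fin.natAdd (stairRows L + r) c) • w (Sum.inr i) := by
    intro c
    rw [h3, hgk, Fin.sum_univ_add]
    simp
  refine ⟨b, s + r, r :: L, B, w, hB.blocks_pos, ?_, ?_,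
    fun i => (congrArg f (h1 i)).trans (hv _), fun i => (congrArg f (h2 i)).trans (hv _),
    fun c => (congrArg f (h3 c)).trans (k c).2, fun j => (congrArg g (h1 j)).trans (hgv _),
    fun j => Fin.addCases hl hr' j⟩
  · rintro x (_ | ⟨_, hx⟩)
    · omega
    · exact hB.steps_pos x hx
  · exact List.isChain_cons_cons.2 ⟨by simp, hB.steps_desc⟩

end Staircase

/-! ### Staircase blocks: surjectivity and kernels -/

/-- Concatenation of vectors as a linear equivalence. -/
noncomputable def appendEquiv (m n : ℕ) :
    ((Fin m → ℂ) × (Fin n → ℂ)) ≃ₗ[ℂ] (Fin (m + n) → ℂ) :=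
  (LinearEquiv.sumArrowLequivProdArrow (Fin m) (Fin n) ℂ ℂ).symm.trans
    (LinearEquiv.funCongrLeft ℂ ℂ finSumFinEquiv.symm)

@[simp] theorem appendEquiv_castAdd {m n : ℕ} (p : (Fin m → ℂ) × (Fin n → ℂ)) (i : Fin m) :
    appendEquiv m n p (Fin.castAdd n i) = p.1 i := by
  simp [appendEquiv, LinearEquiv.funCongrLeft_apply, LinearMap.funLeft_apply]
  rfl

@[simp] theorem appendEquiv_natAdd {m n : ℕ} (p : (Fin m → ℂ) × (Fin n → ℂ)) (i : Fin n) :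
    appendEquiv m n p (Fin.natAdd m i) = p.2 i := by
  simp [appendEquiv, LinearEquiv.funCongrLeft_apply, LinearMap.funLeft_apply]
  rfl

theorem diagSum_mulVec_appendEquiv {m n m' n' : ℕ} (A : Matrix (Fin m) (Fin n) ℂ)
    (B : Matrix (Fin m') (Fin n') ℂ) (p : (Fin n → ℂ) × (Fin n' → ℂ)) :
    diagSum A B *ᵥ appendEquiv n n' p = appendEquiv m m' (A *ᵥ p.1, B *ᵥ p.2) := by
  ext i
  refine Fin.addCases (fun i => ?_) (fun i => ?_) i <;>
  simp [Matrix.mulVec, dotProduct, Fin.sum_univ_add]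

theorem rightIdentity_mulVec {r c : ℕ} (h : r ≤ c) (u : Fin c → ℂ) (i : Fin r) :
    (rightIdentity r c *ᵥ u) i = u ⟨i + (c - r), by omega⟩ := by
  rw [Matrix.mulVec, dotProduct, Finset.sum_eq_single ⟨i + (c - r), by omega⟩]
  · simp only [rightIdentity, Matrix.of_apply]
    rw [if_pos (by omega), one_mul]
  · intro j _ hj
    simp only [rightIdentity, Matrix.of_apply]
    rw [if_neg, zero_mul]
    intro h'
    apply hj
    ext
    simp only
    omega
  · simp

/-- Extension of a family by a constant on the left. -/
def extendLeft {α : Type*} {r c : ℕ} (a : α) (z : Fin r → α) : Fin c → α :=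
  fun j => if h : c ≤ j + r ∧ j + r < c + r then z ⟨j + r - c, by omega⟩ else a

theorem extendLeft_apply {α : Type*} {r c : ℕ} (hrc : r ≤ c) (a : α) (z : Fin r → α) (i : Fin r) :
    extendLeft a z (⟨i + (c - r), by omega⟩ : Fin c) = z i := by
  rw [extendLeft, dif_pos (by simp only; omega)]
  congr 1
  ext
  simp only
  omega

theorem extendLeft_mem {α : Type*} {r c : ℕ} (a : α) (z : Fin r → α) (j : Fin c) (S : Set α)
    (ha : a ∈ S) (hz : ∀ i, z i ∈ S) : extendLeft a z j ∈ S := by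
  rw [extendLeft]
  split_ifs
  · exact hz _
  · exact ha

theorem rightIdentity_mulVec_extendLeft {r c : ℕ} (h : r ≤ c) (z : Fin r → ℂ) :
    rightIdentity r c *ᵥ (extendLeft 0 z) = z := by
  ext i
  rw [rightIdentity_mulVec h, extendLeft_apply h]

theorem stairMatrix_cons_mulVec (r₀ r : ℕ) (L : List ℕ)
    (p : (Fin (stairRows L + r) → ℂ) × (Fin r₀ → ℂ)) :
    stairMatrix r₀ (r :: L) *ᵥ appendEquiv (stairRows L + r) r₀ p =
      appendEquiv (stairRows L) r (stairMatrix r L *ᵥ p.1, rightIdentity r r₀ *ᵥ p.2) :=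
  diagSum_mulVec_appendEquiv _ _ _

/-- A nonzero combination of the two blocks of a staircase has full row rank. -/
theorem stair_surjective (L : List ℕ) (r₀ : ℕ) (hL : (r₀ :: L).IsChain (· ≥ ·)) (a b : ℂ)
    (hab : a ≠ 0 ∨ b ≠ 0) (y : Fin (stairRows L) → ℂ) :
    ∃ x : Fin (stairRows L + r₀) → ℂ,
      a • (fun i => x (Fin.castAdd r₀ i)) + b • (stairMatrix r₀ L *ᵥ x) = y := by
  induction L generalizing r₀ with
  | nil => exact ⟨0, funext fun i => Fin.elim0 i⟩
  | cons r L ih =>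
    obtain ⟨hr, hL⟩ := List.isChain_cons_cons.1 hL
    obtain ⟨⟨y₁, y₂⟩, rfl⟩ := (appendEquiv (stairRows L) r).surjective y
    have key : ∀ p : (Fin (stairRows L + r) → ℂ) × (Fin r₀ → ℂ),
        a • p.1 + b • appendEquiv (stairRows L) r (stairMatrix r L *ᵥ p.1,
          rightIdentity r r₀ *ᵥ p.2) = appendEquiv (stairRows L) r (y₁, y₂) →
        ∃ x : Fin (stairRows (r :: L) + r₀) → ℂ,
          a • (fun i => x (Fin.castAdd r₀ i)) + b • (stairMatrix r₀ (r :: L) *ᵥ x) =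
            appendEquiv (stairRows L) r (y₁, y₂) := by
      intro p hp
      refine ⟨appendEquiv (stairRows L + r) r₀ p, ?_⟩
      rw [stairMatrix_cons_mulVec, ← hp]
      congr 2
      funext i
      exact appendEquiv_castAdd (m := stairRows L + r) p i
    by_cases hb : b = 0
    · have ha : a ≠ 0 := by simpa [hb] using hab
      refine key (a⁻¹ • appendEquiv (stairRows L) r (y₁, y₂), 0) ?_
      rw [hb, zero_smul, add_zero, smul_smul, mul_inv_cancel₀ ha, one_smul]
    -- The smaller staircase fixes all but the bottom column block; that block is free, and since r
    -- ≤ r₀ its last r coordinates solve the remaining r equations.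
    · obtain ⟨x, hx⟩ := ih r hL y₁
      obtain ⟨⟨x₁, x₂⟩, rfl⟩ := (appendEquiv (stairRows L) r).surjective x
      refine key (appendEquiv (stairRows L) r (x₁, x₂),
        extendLeft 0 (b⁻¹ • (y₂ - a • x₂))) ?_
      rw [rightIdentity_mulVec_extendLeft hr, ← map_smul, ← map_smul, ← map_add]
      congr 1
      ext1
      · simpa using hx
      · simp [smul_smul, hb]

/-- The sequence `j ↦ R (s (j + 1))`, where `R` keeps the last `r` coordinates. -/
noncomputable def lowShift (r₀ r : ℕ) : (ℕ → Fin r₀ → ℂ) →ₗ[ℂ] (ℕ → Fin r → ℂ) :=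
  LinearMap.pi fun j => Matrix.toLin' (rightIdentity r r₀) ∘ₗ LinearMap.proj (j + 1)

@[simp] theorem lowShift_apply (r₀ r : ℕ) (s : ℕ → Fin r₀ → ℂ) (j : ℕ) :
    lowShift r₀ r s j = rightIdentity r r₀ *ᵥ s (j + 1) := by
  simp [lowShift]

/-- The column vector of a staircase whose `j`-th block from the bottom is made of the last
coordinates of the `j`-th term of a sequence. -/
noncomputable def stairVec : (r₀ : ℕ) → (L : List ℕ) →
    (ℕ → Fin r₀ → ℂ) →ₗ[ℂ] (Fin (stairRows L + r₀) → ℂ)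
  | r₀, [] => (appendEquiv 0 r₀).toLinearMap ∘ₗ LinearMap.prod 0 (LinearMap.proj 0)
  | r₀, r :: L => (appendEquiv (stairRows L + r) r₀).toLinearMap ∘ₗ
      LinearMap.prod (stairVec r L ∘ₗ lowShift r₀ r) (LinearMap.proj 0)

theorem stairVec_cons (r₀ r : ℕ) (L : List ℕ) (s : ℕ → Fin r₀ → ℂ) :
    stairVec r₀ (r :: L) s =
      appendEquiv (stairRows L + r) r₀ (stairVec r L (lowShift r₀ r s), s 0) := rfl

theorem stairVec_nil (r₀ : ℕ) (s : ℕ → Fin r₀ → ℂ) :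
    stairVec r₀ [] s = appendEquiv 0 r₀ (0, s 0) := rfl

theorem stairVec_natAdd (r₀ : ℕ) (L : List ℕ) (s : ℕ → Fin r₀ → ℂ) (c : Fin r₀) :
    stairVec r₀ L s (Fin.natAdd _ c) = s 0 c := by
  cases L with
  | nil => exact appendEquiv_natAdd (m := 0) (0, s 0) c
  | cons r L => exact appendEquiv_natAdd (m := stairRows L + r) _ c

/-- The kernel of `E₁ - μ E₂`. -/
noncomputable def stairKer (r₀ : ℕ) (L : List ℕ) (μ : ℂ) :
    Submodule ℂ (Fin (stairRows L + r₀) → ℂ) :=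
  LinearMap.ker (LinearMap.funLeft ℂ ℂ (Fin.castAdd r₀) - μ • Matrix.toLin' (stairMatrix r₀ L))

theorem mem_stairKer {r₀ : ℕ} {L : List ℕ} {μ : ℂ} {x : Fin (stairRows L + r₀) → ℂ} :
    x ∈ stairKer r₀ L μ ↔ (fun i => x (Fin.castAdd r₀ i)) = μ • (stairMatrix r₀ L *ᵥ x) := by
  rw [stairKer, LinearMap.mem_ker, LinearMap.sub_apply, sub_eq_zero]
  rfl

theorem mem_stairKer_cons {r₀ r : ℕ} {L : List ℕ} {μ : ℂ}
    {p : (Fin (stairRows L) → ℂ) × (Fin r → ℂ)} {c : Fin r₀ → ℂ} :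
    appendEquiv (stairRows L + r) r₀ (appendEquiv (stairRows L) r p, c) ∈ stairKer r₀ (r :: L) μ ↔
      appendEquiv (stairRows L) r p ∈ stairKer r L μ ∧
        p.2 = μ • (rightIdentity r r₀ *ᵥ c) := by
  have h1 : (fun i : Fin (stairRows (r :: L)) => appendEquiv (stairRows L + r) r₀
      (appendEquiv (stairRows L) r p, c) (Fin.castAdd r₀ i)) = appendEquiv (stairRows L) r p := by
    funext i
    exact appendEquiv_castAdd (m := stairRows L + r) _ i
  have h2 := stairMatrix_cons_mulVec r₀ r L (appendEquiv (stairRows L) r p, c)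
  have h3 : ∀ q : (Fin (stairRows L) → ℂ) × (Fin r → ℂ), appendEquiv (stairRows L) r p =
      μ • appendEquiv (stairRows L) r q ↔ p.1 = μ • q.1 ∧ p.2 = μ • q.2 := by
    intro q
    rw [← map_smul, (appendEquiv (stairRows L) r).injective.eq_iff, Prod.ext_iff]
    rfl
  have h4 : (fun i => appendEquiv (stairRows L) r p (Fin.castAdd r i)) = p.1 :=
    funext fun i => appendEquiv_castAdd p i
  refine (mem_stairKer (L := r :: L)).trans
    ((Eq.congr h1 (congrArg (μ • ·) h2)).trans ((h3 _).trans ?_))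
  rw [mem_stairKer, h4]

/-- Blockwise the kernel equation reads x_j = μ R x_{j-1}, where R keeps the last r_j coordinates.
The bottom block u is therefore free and determines the rest through the geometric sequence μ^j u.
-/
theorem stairKer_eq (L : List ℕ) (r₀ : ℕ) (μ : ℂ) (x : Fin (stairRows L + r₀) → ℂ) :
    x ∈ stairKer r₀ L μ ↔ ∃ u, x = stairVec r₀ L fun j => μ ^ j • u := by
  induction L generalizing r₀ with
  | nil =>
    obtain ⟨⟨x₁, x₂⟩, rfl⟩ := (appendEquiv 0 r₀).surjective x
    refine iff_of_true (mem_stairKer.2 (funext fun i => Fin.elim0 i)) ⟨x₂, ?_⟩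
    rw [stairVec_nil, Subsingleton.elim x₁ 0, pow_zero, one_smul]
  | cons r L ih =>
    obtain ⟨⟨x, c⟩, rfl⟩ := (appendEquiv (stairRows L + r) r₀).surjective x
    obtain ⟨p, rfl⟩ := (appendEquiv (stairRows L) r).surjective x
    refine mem_stairKer_cons.trans ?_
    rw [ih]
    have hlow : ∀ u : Fin r₀ → ℂ, (lowShift r₀ r fun j => μ ^ j • u) =
        fun j => μ ^ j • μ • (rightIdentity r r₀ *ᵥ u) := by
      intro u
      funext j
      rw [lowShift_apply, Matrix.mulVec_smul, pow_succ, mul_smul]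
    have hbot : ∀ u, appendEquiv (stairRows L) r p = stairVec r L (fun j => μ ^ j • u) →
        p.2 = u := by
      intro u hu
      funext i
      have := congrFun hu (Fin.natAdd _ i)
      rwa [appendEquiv_natAdd, stairVec_natAdd, pow_zero, one_smul] at this
    constructor
    · rintro ⟨⟨u, hu⟩, hp⟩
      refine ⟨c, ?_⟩
      rw [stairVec_cons, hlow, ← hp, hbot u hu, hu, pow_zero, one_smul]
    · rintro ⟨u, hu⟩
      rw [stairVec_cons, hlow] at hu
      obtain ⟨h1, h2⟩ := Prod.ext_iff.1 ((appendEquiv (stairRows L + r) r₀).injective hu)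
      simp only [pow_zero, one_smul] at h1 h2
      exact ⟨⟨_, h1⟩, by rw [h2]; exact hbot _ h1⟩

/-! ### Dimension of sums of staircase kernels -/

/-- The sequences of vectors all of whose coordinates lie in a space of scalar sequences. -/
def coordSubmodule (S : Submodule ℂ (ℕ → ℂ)) (r : ℕ) : Submodule ℂ (ℕ → Fin r → ℂ) where
  carrier := {s | ∀ c, (fun j => s j c) ∈ S}
  add_mem' hs ht c := S.add_mem (hs c) (ht c)
  zero_mem' _ := S.zero_mem
  smul_mem' a _ hs c := S.smul_mem a (hs c)

/-- The first `n` terms of a sequence in `S` are arbitrary and determine the sequence. -/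
def IsInterpolating (S : Submodule ℂ (ℕ → ℂ)) (n : ℕ) : Prop :=
  ∀ y : Fin n → ℂ, ∃! s, s ∈ S ∧ ∀ i : Fin n, s i = y i

/-- The shifts of the sequences in `S` that start with zero. -/
def tailSubmodule (S : Submodule ℂ (ℕ → ℂ)) : Submodule ℂ (ℕ → ℂ) :=
  (S ⊓ LinearMap.ker (LinearMap.proj 0)).map (LinearMap.funLeft ℂ ℂ Nat.succ)

theorem mem_tailSubmodule {S : Submodule ℂ (ℕ → ℂ)} {t : ℕ → ℂ} :
    t ∈ tailSubmodule S ↔ ∃ s ∈ S, s 0 = 0 ∧ ∀ j, s (j + 1) = t j := by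
  rw [tailSubmodule, Submodule.mem_map]
  constructor
  · rintro ⟨s, ⟨hs, h0⟩, rfl⟩
    exact ⟨s, hs, h0, fun j => rfl⟩
  · rintro ⟨s, hs, h0, h⟩
    exact ⟨s, ⟨hs, h0⟩, funext h⟩

/-- The zero initial term uses up one of the n + 1 free values; the others are the first n terms of
the shifted sequence. -/
theorem IsInterpolating.tail {S : Submodule ℂ (ℕ → ℂ)} {n : ℕ} (h : IsInterpolating S (n + 1)) :
    IsInterpolating (tailSubmodule S) n := by
  intro y
  obtain ⟨s, ⟨hs, hsy⟩, huniq⟩ := h (Fin.cons 0 y)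
  have h0 : s 0 = 0 := hsy 0
  refine ⟨fun j => s (j + 1), ⟨mem_tailSubmodule.2 ⟨s, hs, h0, fun _ => rfl⟩, fun i => ?_⟩, ?_⟩
  · simpa using hsy i.succ
  · rintro t ⟨ht, hty⟩
    obtain ⟨s', hs', h0', h'⟩ := mem_tailSubmodule.1 ht
    have : s' = s := huniq s' ⟨hs', fun i => by
      refine Fin.cases (by simpa using h0') (fun i => ?_) i
      simp [h', hty]⟩
    subst this
    exact funext fun j => (h' j).symm

theorem finrank_eq_add_of_map_snd {E F : Type*} [AddCommGroup E] [Module ℂ E]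
    [FiniteDimensional ℂ E] [AddCommGroup F] [Module ℂ F] [FiniteDimensional ℂ F]
    (X : Submodule ℂ (E × F)) (Y : Submodule ℂ E) (hF : ∀ y, ∃ x, (x, y) ∈ X)
    (hE : ∀ x, (x, 0) ∈ X ↔ x ∈ Y) :
    Module.finrank ℂ X = Module.finrank ℂ F + Module.finrank ℂ Y := by
  let π : X →ₗ[ℂ] F := LinearMap.snd ℂ E F ∘ₗ X.subtype
  have hπ : LinearMap.range π = ⊤ := by
    refine LinearMap.range_eq_top.2 fun y => ?_
    obtain ⟨x, hx⟩ := hF y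
    exact ⟨⟨(x, y), hx⟩, rfl⟩
  let e : Y ≃ₗ[ℂ] LinearMap.ker π := LinearEquiv.ofBijective
    (((LinearMap.inl ℂ E F ∘ₗ Y.subtype).codRestrict X fun x => (hE x).2 x.2).codRestrict
      (LinearMap.ker π) fun x => rfl) (by
      constructor
      · intro x y hxy
        have := congrArg (fun z : LinearMap.ker π => (z : X).1.1) hxy
        exact Subtype.ext this
      · rintro ⟨⟨⟨x, y⟩, hx⟩, hy⟩
        have hy : y = 0 := hy
        subst hy
        exact ⟨⟨x, (hE x).1 hx⟩, rfl⟩)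
  rw [← LinearMap.finrank_range_add_finrank_ker π, hπ, finrank_top, e.finrank_eq]

theorem coordSubmodule_eq_bot {S : Submodule ℂ (ℕ → ℂ)} (hS : IsInterpolating S 0) (r : ℕ) :
    coordSubmodule S r = ⊥ := by
  rw [eq_bot_iff]
  intro s hs
  obtain ⟨_, -, huniq⟩ := hS Fin.elim0
  refine funext fun j => funext fun c => ?_
  have h1 := huniq _ ⟨hs c, fun i => i.elim0⟩
  have h2 := huniq _ ⟨S.zero_mem, fun i => i.elim0⟩
  exact congrFun (h1.trans h2.symm) j

/-- The bottom block s 0 is arbitrary and contributes r₀. The vectors with zero bottom block come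
from the shifted sequences on the shorter staircase, with n - 1 free terms. General spaces S are
allowed because `tailSubmodule` does not preserve the spaces of power sums to which the result is
applied. -/
theorem finrank_map_stairVec (L : List ℕ) (r₀ n : ℕ) (S : Submodule ℂ (ℕ → ℂ))
    (hL : (r₀ :: L).IsChain (· ≥ ·)) (hS : IsInterpolating S n) :
    Module.finrank ℂ ((coordSubmodule S r₀).map (stairVec r₀ L)) = ((r₀ :: L).take n).sum := by
  induction L generalizing r₀ n S with
  | nil =>
    cases n with
    | zero =>
      rw [coordSubmodule_eq_bot hS]
      simp
    | succ n =>
      have htop : (coordSubmodule S r₀).map (stairVec r₀ []) = ⊤ := by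
        rw [eq_top_iff]
        intro x _
        obtain ⟨⟨x₁, x₂⟩, rfl⟩ := (appendEquiv 0 r₀).surjective x
        choose s hs _ using fun c : Fin r₀ => hS (Fin.cons (x₂ c) 0)
        refine ⟨fun j c => s c j, fun c => (hs c).1, ?_⟩
        rw [stairVec_nil, Subsingleton.elim x₁ 0]
        congr 2
        exact funext fun c => (hs c).2 0
      rw [htop, finrank_top, Module.finrank_fin_fun]
      simp [stairRows]
  | cons r L ih =>
    cases n with
    | zero =>
      rw [coordSubmodule_eq_bot hS]
      simp
    | succ n =>
      obtain ⟨hr, hL'⟩ := List.isChain_cons_cons.1 hL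
      rw [List.take_succ_cons, List.sum_cons, ← ih r n (tailSubmodule S) hL' hS.tail]
      have hcomp : stairVec r₀ (r :: L) = (appendEquiv (stairRows L + r) r₀).toLinearMap ∘ₗ
        LinearMap.prod (stairVec r L ∘ₗ lowShift r₀ r) (LinearMap.proj 0) := rfl
      have hfin := (appendEquiv (stairRows L + r) r₀).finrank_map_eq ((coordSubmodule S r₀).map
        (LinearMap.prod (stairVec r L ∘ₗ lowShift r₀ r) (LinearMap.proj 0)))
      rw [← Submodule.map_comp] at hfin
      refine hfin.trans ?_
      rw [finrank_eq_add_of_map_snd _ ((coordSubmodule (tailSubmodule S) r).map (stairVec r L)),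
        Module.finrank_fin_fun]
      · intro y
        choose s hs _ using fun c : Fin r₀ => hS (Fin.cons (y c) 0)
        refine ⟨stairVec r L (lowShift r₀ r fun j c => s c j), fun j c => s c j,
          fun c => (hs c).1, ?_⟩
        refine Prod.ext rfl ?_
        exact funext fun c => (hs c).2 0
      · intro x
        constructor
        · rintro ⟨s, hs, hsx⟩
          obtain ⟨h1, h2⟩ := Prod.ext_iff.1 hsx
          refine ⟨lowShift r₀ r s, fun i => ?_, h1⟩
          refine mem_tailSubmodule.2 ⟨_, hs ⟨i + (r₀ - r), by omega⟩, congrFun h2 _, fun j => ?_⟩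
          rw [lowShift_apply, rightIdentity_mulVec hr]
        · rintro ⟨t, ht, rfl⟩
          choose s hs h0 hst using fun i => mem_tailSubmodule.1 (ht i)
          -- The coordinates that R discards are filled with the zero sequence.
          have hmem : ∀ c, (extendLeft 0 s : Fin r₀ → ℕ → ℂ) c ∈ S ∧
              (extendLeft 0 s : Fin r₀ → ℕ → ℂ) c 0 = 0 := fun c =>
            extendLeft_mem 0 s c {u | u ∈ S ∧ u 0 = 0} ⟨S.zero_mem, rfl⟩
              fun i => ⟨hs i, h0 i⟩
          refine ⟨fun j c => (extendLeft 0 s : Fin r₀ → ℕ → ℂ) c j, fun c => (hmem c).1, ?_⟩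
          refine Prod.ext ?_ (funext fun c => (hmem c).2)
          refine congrArg (stairVec r L) (funext fun j => funext fun i => ?_)
          rw [lowShift_apply, rightIdentity_mulVec hr, extendLeft_apply hr, hst]

/-- The sequences of power sums with nodes `μ`. -/
noncomputable def powerSums {n : ℕ} (μ : Fin n → ℂ) : Submodule ℂ (ℕ → ℂ) :=
  LinearMap.range (LinearMap.pi fun j : ℕ => ∑ i, μ i ^ j • (LinearMap.proj i : (Fin n → ℂ) →ₗ[ℂ] ℂ))

theorem mem_powerSums {n : ℕ} {μ : Fin n → ℂ} {s : ℕ → ℂ} :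
    s ∈ powerSums μ ↔ ∃ a : Fin n → ℂ, ∀ j, ∑ i, μ i ^ j * a i = s j := by
  simp [powerSums, LinearMap.mem_range, funext_iff, LinearMap.sum_apply]

/-- The map from the weights to the first n power sums is a transposed Vandermonde matrix,
invertible for distinct nodes. -/
theorem isInterpolating_powerSums {n : ℕ} (μ : Fin n → ℂ) (hμ : Function.Injective μ) :
    IsInterpolating (powerSums μ) n := by
  have hU : IsUnit (Matrix.vandermonde μ)ᵀ := by
    rw [Matrix.isUnit_iff_isUnit_det, Matrix.det_transpose, isUnit_iff_ne_zero]
    exact Matrix.det_vandermonde_ne_zero_iff.2 hμ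
  have hval : ∀ a j, ((Matrix.vandermonde μ)ᵀ *ᵥ a) j = ∑ i, μ i ^ (j : ℕ) * a i := by
    intro a j
    simp [Matrix.mulVec, dotProduct, Matrix.vandermonde_apply]
  intro y
  obtain ⟨a, ha⟩ := Matrix.mulVec_surjective_iff_isUnit.2 hU y
  refine ⟨fun j => ∑ i, μ i ^ j * a i, ⟨mem_powerSums.2 ⟨a, fun _ => rfl⟩, fun j => ?_⟩, ?_⟩
  · rw [← ha, hval]
  · rintro s ⟨hs, hsy⟩
    obtain ⟨a', ha'⟩ := mem_powerSums.1 hs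
    have : a' = a := by
      refine Matrix.mulVec_injective_iff_isUnit.2 hU (funext fun j => ?_)
      rw [ha, hval, ha', hsy]
    subst this
    exact funext fun j => (ha' j).symm

theorem iSup_stairKer (r₀ : ℕ) (L : List ℕ) {n : ℕ} (μ : Fin n → ℂ) :
    ⨆ i, stairKer r₀ L (μ i) = (coordSubmodule (powerSums μ) r₀).map (stairVec r₀ L) := by
  apply le_antisymm
  · refine iSup_le fun i x hx => ?_
    obtain ⟨u, rfl⟩ := (stairKer_eq L r₀ (μ i) x).1 hx
    refine ⟨_, fun c => mem_powerSums.2 ⟨Pi.single i (u c), fun j => ?_⟩, rfl⟩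
    rw [Finset.sum_eq_single i] <;> simp +contextual
  · rintro _ ⟨s, hs, rfl⟩
    choose a ha using fun c => mem_powerSums.1 (hs c)
    have : s = ∑ i, fun j => μ i ^ j • fun c => a c i := by
      funext j c
      simp [← ha, Finset.sum_apply]
    rw [this, map_sum]
    exact Submodule.sum_mem _ fun i _ => Submodule.mem_iSup_of_mem i
      ((stairKer_eq L r₀ (μ i) _).2 ⟨_, rfl⟩)

/-- The span of the kernels of `E₁ - μ E₂` at `n` points `μ`. -/
theorem finrank_iSup_stairKer (r₀ : ℕ) (L : List ℕ) (hL : (r₀ :: L).IsChain (· ≥ ·)) {n : ℕ}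
    (μ : Fin n → ℂ) (hμ : Function.Injective μ) :
    Module.finrank ℂ (⨆ i, stairKer r₀ L (μ i) : Submodule ℂ _) = ((r₀ :: L).take n).sum := by
  rw [iSup_stairKer, finrank_map_stairVec L r₀ n _ hL (isInterpolating_powerSums μ hμ)]

/-! ### Ranks of powers of α + βJ -/

theorem diagSum_mul {m n k m' n' k' : ℕ} (A : Matrix (Fin m) (Fin n) ℂ)
    (B : Matrix (Fin m') (Fin n') ℂ) (C : Matrix (Fin n) (Fin k) ℂ)
    (D : Matrix (Fin n') (Fin k') ℂ) :
    diagSum A B * diagSum C D = diagSum (A * C) (B * D) := by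
  simp only [diagSum, Matrix.reindex_apply, Matrix.submatrix_mul_equiv, Matrix.fromBlocks_multiply]
  simp

theorem diagSum_one (m n : ℕ) : diagSum (1 : Matrix (Fin m) (Fin m) ℂ)
    (1 : Matrix (Fin n) (Fin n) ℂ) = 1 := by
  simp [diagSum]

theorem diagSum_pow {m n : ℕ} (A : Matrix (Fin m) (Fin m) ℂ) (B : Matrix (Fin n) (Fin n) ℂ)
    (k : ℕ) : diagSum A B ^ k = diagSum (A ^ k) (B ^ k) := by
  induction k with
  | zero => simp [diagSum_one]
  | succ k ih => rw [pow_succ, ih, diagSum_mul, ← pow_succ, ← pow_succ]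

theorem smul_one_add_smul_diagSum {m n : ℕ} (A : Matrix (Fin m) (Fin m) ℂ)
    (B : Matrix (Fin n) (Fin n) ℂ) (α β : ℂ) :
    α • (1 : Matrix (Fin (m + n)) (Fin (m + n)) ℂ) + β • diagSum A B =
      diagSum (α • 1 + β • A) (α • 1 + β • B) := by
  rw [← diagSum_one]
  ext i j
  refine Fin.addCases (fun i => ?_) (fun i => ?_) i <;>
  refine Fin.addCases (fun j => ?_) (fun j => ?_) j <;> simp

theorem rank_diagSum {m n m' n' : ℕ} (A : Matrix (Fin m) (Fin n) ℂ)
    (B : Matrix (Fin m') (Fin n') ℂ) : (diagSum A B).rank = A.rank + B.rank := by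
  have h : (diagSum A B).mulVecLin ∘ₗ (appendEquiv n n').toLinearMap =
      (appendEquiv m m').toLinearMap ∘ₗ (A.mulVecLin.prodMap B.mulVecLin) :=
    LinearMap.ext fun p => diagSum_mulVec_appendEquiv A B p
  have hr : LinearMap.range (diagSum A B).mulVecLin =
      ((LinearMap.range A.mulVecLin).prod (LinearMap.range B.mulVecLin)).map
        (appendEquiv m m').toLinearMap := by
    rw [← LinearMap.range_prodMap, ← LinearMap.range_comp, ← h,
      LinearMap.range_comp_of_range_eq_top _ (appendEquiv n n').range]
  rw [Matrix.rank, hr]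
  refine ((appendEquiv m m').finrank_map_eq _).trans ?_
  have hinj : Function.Injective ((LinearMap.range A.mulVecLin).subtype.prodMap
      (LinearMap.range B.mulVecLin).subtype) :=
    Prod.map_injective.2 ⟨Subtype.val_injective, Subtype.val_injective⟩
  have hfin := LinearMap.finrank_range_of_inj hinj
  rw [LinearMap.range_prodMap, Submodule.range_subtype, Submodule.range_subtype,
    Module.finrank_prod] at hfin
  exact hfin

theorem jordanBlock_zero_pow_apply (m k : ℕ) (i j : Fin m) :
    (jordanBlock m 0 ^ k) i j = if (j : ℕ) = i + k then 1 else 0 := by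
  induction k generalizing j with
  | zero => simp [Matrix.one_apply, Fin.ext_iff, eq_comm]
  | succ k ih =>
    have hN : ∀ l, jordanBlock m 0 l j = if (j : ℕ) = l + 1 then 1 else 0 := by
      intro l
      simp only [jordanBlock, Matrix.of_apply]
      split_ifs <;> first | rfl | omega
    rw [pow_succ, Matrix.mul_apply]
    simp only [ih, hN]
    by_cases h : (j : ℕ) = i + (k + 1)
    · rw [Finset.sum_eq_single ⟨i + k, by omega⟩]
      · simp [h, add_assoc]
      · intro l _ hl
        rw [if_neg, zero_mul]
        exact fun h' => hl (Fin.ext h')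
      · simp
    · rw [if_neg h]
      refine Finset.sum_eq_zero fun l _ => ?_
      split_ifs <;> first | (exfalso; omega) | simp

/-- The power forgets the first k coordinates and then embeds the other m - k as the leading ones.
-/
theorem rank_jordanBlock_zero_pow (m k : ℕ) : (jordanBlock m 0 ^ k).rank = m - k := by
  let p : (Fin m → ℂ) →ₗ[ℂ] (Fin (m - k) → ℂ) :=
    LinearMap.funLeft ℂ ℂ fun i : Fin (m - k) => (⟨i + k, by omega⟩ : Fin m)
  let ι : (Fin (m - k) → ℂ) →ₗ[ℂ] (Fin m → ℂ) :=
    { toFun := fun y i => if h : (i : ℕ) < m - k then y ⟨i, h⟩ else 0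
      map_add' := fun x y => by ext i; by_cases h : (i : ℕ) < m - k <;> simp [h]
      map_smul' := fun a y => by ext i; by_cases h : (i : ℕ) < m - k <;> simp [h] }
  have hp : LinearMap.range p = ⊤ := by
    refine LinearMap.range_eq_top.2 (LinearMap.funLeft_surjective_of_injective _ _ _ ?_)
    intro i j hij
    simp only [Fin.mk.injEq] at hij
    omega
  have hι : Function.Injective ι := by
    intro x y hxy
    ext i
    have := congrFun hxy ⟨i, by omega⟩
    simpa [ι] using this
  have hcomp : (jordanBlock m 0 ^ k).mulVecLin = ι ∘ₗ p := by
    refine LinearMap.ext fun x => funext fun i => ?_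
    simp only [Matrix.mulVecLin_apply, Matrix.mulVec, dotProduct, jordanBlock_zero_pow_apply]
    by_cases h : (i : ℕ) < m - k
    · rw [Finset.sum_eq_single ⟨i + k, by omega⟩]
      · simp [ι, p, h, LinearMap.funLeft_apply]
      · intro l _ hl
        rw [if_neg, zero_mul]
        exact fun h' => hl (Fin.ext h')
      · simp
    · rw [Finset.sum_eq_zero]
      · simp [ι, h]
      · intro l _
        rw [if_neg (by omega), zero_mul]
  rw [Matrix.rank, hcomp, LinearMap.range_comp_of_range_eq_top _ hp,
    LinearMap.finrank_range_of_inj hι, Module.finrank_fin_fun]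

theorem rank_smul_one_add_jordanBlock_pow (m : ℕ) (z α β : ℂ) (h : α ≠ 0 ∨ β ≠ 0) (k : ℕ) :
    ((α • (1 : Matrix (Fin m) (Fin m) ℂ) + β • jordanBlock m z) ^ k).rank =
      if α + β * z = 0 then m - k else m := by
  split_ifs with hz
  · have hβ : β ≠ 0 := by
      rintro rfl
      simp at hz
      simp [hz] at h
    -- With α = -βz the diagonal cancels and a nonzero multiple of the nilpotent block remains.
    have : α • (1 : Matrix (Fin m) (Fin m) ℂ) + β • jordanBlock m z = β • jordanBlock m 0 := by
      ext i j
      simp only [Matrix.add_apply, Matrix.smul_apply, Matrix.one_apply, jordanBlock,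
        Matrix.of_apply, smul_eq_mul]
      split_ifs <;> simp [hz]
    rw [this, smul_pow, Matrix.rank_smul_of_mem_nonZeroDivisors _
      (mem_nonZeroDivisors_of_ne_zero (pow_ne_zero k hβ)), rank_jordanBlock_zero_pow]
  · have : IsUnit (α • (1 : Matrix (Fin m) (Fin m) ℂ) + β • jordanBlock m z) := by
      rw [Matrix.isUnit_iff_isUnit_det, isUnit_iff_ne_zero, Matrix.det_of_isUpperTriangular]
      · refine Finset.prod_ne_zero_iff.2 fun i _ => ?_
        simpa [jordanBlock] using hz
      · intro i j hij
        have hij : (j : ℕ) < i := hij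
        have h1 : i ≠ j := fun h => by simp [h] at hij
        have h2 : ¬ (j : ℕ) = i + 1 := by omega
        simp [jordanBlock, h1, h2]
    rw [Matrix.rank_of_isUnit _ (this.pow k), Fintype.card_fin]

/-- The rank of a power of `α + β J`. -/
theorem rank_smul_one_add_jordanMatrix_pow (b : List (ℕ × ℂ)) (α β : ℂ) (h : α ≠ 0 ∨ β ≠ 0)
    (k : ℕ) :
    ((α • (1 : Matrix (Fin (jordanSize b)) (Fin (jordanSize b)) ℂ) + β • jordanMatrix b) ^ k).rank =
      (b.map fun x => if α + β * x.2 = 0 then x.1 - k else x.1).sum := by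
  induction b with
  | nil =>
    have := Matrix.rank_le_height
      ((α • (1 : Matrix (Fin (jordanSize [])) (Fin (jordanSize [])) ℂ) + β • jordanMatrix []) ^ k)
    exact Nat.le_zero.1 this
  | cons x b ih =>
    have h1 := smul_one_add_smul_diagSum (jordanBlock x.1 x.2) (jordanMatrix b) α β
    have h2 := rank_diagSum ((α • (1 : Matrix (Fin x.1) (Fin x.1) ℂ) + β • jordanBlock x.1 x.2) ^ k)
      ((α • (1 : Matrix (Fin (jordanSize b)) (Fin (jordanSize b)) ℂ) + β • jordanMatrix b) ^ k)
    rw [← diagSum_pow, ← h1, ih, rank_smul_one_add_jordanBlock_pow _ _ _ _ h] at h2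
    rw [List.map_cons, List.sum_cons]
    exact h2

theorem jordanSize_eq_sum (b : List (ℕ × ℂ)) : jordanSize b = (b.map Prod.fst).sum := by
  induction b with
  | nil => rfl
  | cons x b ih => simp [jordanSize, ih]

theorem isUnit_smul_one_add_jordanMatrix (b : List (ℕ × ℂ)) (α β : ℂ)
    (hb : ∀ x ∈ b, α + β * x.2 ≠ 0) :
    IsUnit (α • (1 : Matrix (Fin (jordanSize b)) (Fin (jordanSize b)) ℂ) + β • jordanMatrix b) := by
  rcases b with - | ⟨y, b⟩
  · rw [Matrix.isUnit_iff_isUnit_det]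
    have : IsEmpty (Fin (jordanSize [])) := inferInstanceAs (IsEmpty (Fin 0))
    simp
  have h : α ≠ 0 ∨ β ≠ 0 := by
    by_contra! h
    exact hb y (by simp) (by simp [h.1, h.2])
  have := rank_smul_one_add_jordanMatrix_pow (y :: b) α β h 1
  rw [List.map_congr_left (g := Prod.fst) fun x hx => if_neg (hb x hx), ← jordanSize_eq_sum,
    pow_one] at this
  rw [← Matrix.mulVec_surjective_iff_isUnit]
  refine LinearMap.range_eq_top.1 (Submodule.eq_top_of_finrank_eq (this.trans ?_))
  rw [Module.finrank_fin_fun]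

theorem ne_zero_of_isUnit_smul_one_add_jordanMatrix (b : List (ℕ × ℂ)) (hpos : ∀ x ∈ b, 0 < x.1)
    (α β : ℂ) (h : α ≠ 0 ∨ β ≠ 0)
    (hb : IsUnit (α • (1 : Matrix (Fin (jordanSize b)) (Fin (jordanSize b)) ℂ) +
      β • jordanMatrix b)) : ∀ x ∈ b, α + β * x.2 ≠ 0 := by
  intro x hx h0
  have h1 := rank_smul_one_add_jordanMatrix_pow b α β h 1
  rw [pow_one, Matrix.rank_of_isUnit _ hb, Fintype.card_fin, jordanSize_eq_sum] at h1
  refine absurd h1 (ne_of_gt ?_)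
  refine List.sum_lt_sum _ _ (fun y _ => ?_) ⟨x, hx, ?_⟩
  · split_ifs <;> omega
  · rw [if_pos h0]
    have := hpos x hx
    omega

/-! ### Invariance of the staircase -/

section Uniqueness

variable {V W : Type*} [AddCommGroup V] [Module ℂ V] [AddCommGroup W] [Module ℂ W]
  {f g : V →ₗ[ℂ] W} {b : List (ℕ × ℂ)} {r₀ : ℕ} {L : List ℕ}

/-- Coordinates in which a pair of linear maps takes the normal form with Jordan blocks `b`, base
width `r₀` and steps `L`. -/
structure KroneckerCoords (f g : V →ₗ[ℂ] W) (b : List (ℕ × ℂ)) (r₀ : ℕ) (L : List ℕ) where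
  src : ((Fin (jordanSize b) → ℂ) × (Fin (stairRows L + r₀) → ℂ)) ≃ₗ[ℂ] V
  tgt : ((Fin (jordanSize b) → ℂ) × (Fin (stairRows L) → ℂ)) ≃ₗ[ℂ] W
  blocks_pos : ∀ x ∈ b, 0 < x.1
  steps_pos : ∀ r ∈ L, 0 < r
  steps_desc : (r₀ :: L).IsChain (· ≥ ·)
  map_fst : ∀ p, f (src p) = tgt (p.1, fun i => p.2 (Fin.castAdd r₀ i))
  map_snd : ∀ p, g (src p) = tgt (jordanMatrix b *ᵥ p.1, stairMatrix r₀ L *ᵥ p.2)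

namespace KroneckerCoords

variable (h : KroneckerCoords f g b r₀ L)

include h

theorem map_combination (α β : ℂ) (p : (Fin (jordanSize b) → ℂ) × (Fin (stairRows L + r₀) → ℂ)) :
    (α • f + β • g) (h.src p) =
      h.tgt ((α • (1 : Matrix (Fin (jordanSize b)) (Fin (jordanSize b)) ℂ) +
          β • jordanMatrix b) *ᵥ p.1,
        α • (fun i => p.2 (Fin.castAdd r₀ i)) + β • (stairMatrix r₀ L *ᵥ p.2)) := by
  rw [LinearMap.add_apply, LinearMap.smul_apply, LinearMap.smul_apply, h.map_fst, h.map_snd,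
    ← map_smul, ← map_smul, ← map_add]
  congr 1
  ext1
  · simp [Matrix.add_mulVec, Matrix.smul_mulVec]
  · rfl

theorem isUnit_of_surjective (α β : ℂ) (hs : Function.Surjective (α • f + β • g)) :
    IsUnit (α • (1 : Matrix (Fin (jordanSize b)) (Fin (jordanSize b)) ℂ) + β • jordanMatrix b) := by
  rw [← Matrix.mulVec_surjective_iff_isUnit]
  intro y
  obtain ⟨x, hx⟩ := hs (h.tgt (y, 0))
  obtain ⟨p, rfl⟩ := h.src.surjective x
  rw [h.map_combination] at hx
  exact ⟨p.1, (Prod.ext_iff.1 (h.tgt.injective hx)).1⟩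

theorem surjective_of_isUnit (α β : ℂ) (hαβ : α ≠ 0 ∨ β ≠ 0)
    (hu : IsUnit (α • (1 : Matrix (Fin (jordanSize b)) (Fin (jordanSize b)) ℂ) +
      β • jordanMatrix b)) : Function.Surjective (α • f + β • g) := by
  intro y
  obtain ⟨⟨y₁, y₂⟩, rfl⟩ := h.tgt.surjective y
  obtain ⟨x₁, hx₁⟩ := Matrix.mulVec_surjective_iff_isUnit.2 hu y₁
  obtain ⟨x₂, hx₂⟩ := stair_surjective L r₀ h.steps_desc α β hαβ y₂
  refine ⟨h.src (x₁, x₂), ?_⟩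
  rw [h.map_combination]
  exact congrArg h.tgt (Prod.ext hx₁ hx₂)

theorem surjective_fst : Function.Surjective f := by
  have := h.surjective_of_isUnit 1 0 (Or.inl one_ne_zero) (by simp)
  simpa using this

/-- Under the hypothesis 1 - μJ is invertible, so the kernel has no Jordan component. -/
theorem ker_sub_smul (μ : ℂ) (hμ : ∀ x ∈ b, 1 - μ * x.2 ≠ 0) :
    LinearMap.ker (f - μ • g) =
      (stairKer r₀ L μ).map (h.src.toLinearMap ∘ₗ LinearMap.inr ℂ _ _) := by
  have hu := isUnit_smul_one_add_jordanMatrix b 1 (-μ) fun x hx => by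
    simpa [sub_eq_add_neg] using hμ x hx
  have hfg : f - μ • g = (1 : ℂ) • f + (-μ) • g := by
    rw [one_smul, neg_smul, sub_eq_add_neg]
  ext x
  obtain ⟨⟨p₁, p₂⟩, rfl⟩ := h.src.surjective x
  rw [LinearMap.mem_ker, hfg, h.map_combination]
  constructor
  · intro h0
    obtain ⟨h1, h2⟩ := Prod.ext_iff.1 (h.tgt.injective (h0.trans (map_zero h.tgt).symm))
    have hp₁ : p₁ = 0 := Matrix.mulVec_injective_iff_isUnit.2 hu (h1.trans (mulVec_zero _).symm)
    subst hp₁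
    refine ⟨p₂, mem_stairKer.2 ?_, rfl⟩
    simp only [one_smul, neg_smul, Prod.snd_zero] at h2
    exact add_neg_eq_zero.1 h2
  · rintro ⟨k, hk, hkx⟩
    obtain ⟨h1, h2⟩ := Prod.ext_iff.1 (h.src.injective hkx)
    simp only [LinearMap.inr_apply] at h1 h2
    subst h1 h2
    rw [SetLike.mem_coe, mem_stairKer] at hk
    rw [hk]
    simp

theorem finrank_iSup_ker {n : ℕ} (μ : Fin n → ℂ) (hinj : Function.Injective μ)
    (hμ : ∀ i, ∀ x ∈ b, 1 - μ i * x.2 ≠ 0) :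
    Module.finrank ℂ (⨆ i, LinearMap.ker (f - μ i • g) : Submodule ℂ V) =
      ((r₀ :: L).take n).sum := by
  have hi : Function.Injective (h.src.toLinearMap ∘ₗ LinearMap.inr ℂ (Fin (jordanSize b) → ℂ)
      (Fin (stairRows L + r₀) → ℂ)) := h.src.injective.comp LinearMap.inr_injective
  rw [← finrank_iSup_stairKer r₀ L h.steps_desc μ hinj,
    (Submodule.equivMapOfInjective _ hi _).finrank_eq, Submodule.map_iSup]
  rw [iSup_congr fun i => h.ker_sub_smul _ (hμ i)]

end KroneckerCoords

/-- Each nonzero pair excludes at most one value of μ, and ℂ is infinite. -/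
theorem exists_injective_avoiding (F : List (ℂ × ℂ)) (hF : ∀ x ∈ F, x.1 ≠ 0 ∨ x.2 ≠ 0) :
    ∃ μ : ℕ → ℂ, Function.Injective μ ∧ ∀ i, ∀ x ∈ F, x.1 - μ i * x.2 ≠ 0 := by
  have hinf : ((F.map fun x => x.1 / x.2).toFinset : Set ℂ)ᶜ.Infinite :=
    (Finset.finite_toSet _).infinite_compl
  let e := hinf.natEmbedding
  refine ⟨fun i => e i, Subtype.val_injective.comp e.injective, fun i x hx h0 => (e i).2 ?_⟩
  have h2 : x.2 ≠ 0 := by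
    intro h2
    rcases hF x hx with h1 | h1
    · exact h1 (by simpa [h2] using h0)
    · exact h1 h2
  rw [Finset.mem_coe, List.mem_toFinset, List.mem_map]
  exact ⟨x, hx, by rw [div_eq_iff h2]; exact sub_eq_zero.1 h0⟩

theorem eq_of_sum_take_eq (l l' : List ℕ) (hl : ∀ r ∈ l, 0 < r) (hl' : ∀ r ∈ l', 0 < r)
    (h : ∀ n, (l.take n).sum = (l'.take n).sum) : l = l' := by
  induction l generalizing l' with
  | nil =>
    cases l' with
    | nil => rfl
    | cons r l' =>
      have h1 := h 1
      have h2 := hl' r (by simp)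
      simp at h1
      omega
  | cons r l ih =>
    cases l' with
    | nil =>
      have h1 := h 1
      have h2 := hl r (by simp)
      simp at h1
      omega
    | cons r' l' =>
      have h1 : r = r' := by simpa using h 1
      subst h1
      congr 1
      refine ih l' (fun x hx => hl x (by simp [hx])) (fun x hx => hl' x (by simp [hx])) fun n => ?_
      simpa using h (n + 1)

section Transform

variable {b' : List (ℕ × ℂ)} {r₀' : ℕ} {L' : List ℕ} (t₁₁ t₁₂ t₂₁ t₂₂ : ℂ)
  (hdet : t₁₁ * t₂₂ - t₁₂ * t₂₁ ≠ 0) (h : KroneckerCoords f g b r₀ L)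
  (h' : KroneckerCoords (t₁₁ • f + t₁₂ • g) (t₂₁ • f + t₂₂ • g) b' r₀' L')

include hdet h h'

/-- The kernel of the transformed pencil at μ is the kernel of the original one at a Möbius image ν
of μ. Both partial sums are thus the dimension of the same sum of n kernels. -/
theorem KroneckerCoords.sum_take_eq (n : ℕ) :
    ((r₀ :: L).take n).sum = ((r₀' :: L').take n).sum := by
  -- The excluded values are those for which ν is infinite, those with 1 - νλ = 0 for an eigenvalue
  -- λ of the first form, and those with 1 - μλ' = 0 for an eigenvalue λ' of the second.
  obtain ⟨μ, hinj, hμ⟩ := exists_injective_avoiding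
    ((t₁₁, t₂₁) :: (b.map (fun x => (t₁₁ + t₁₂ * x.2, t₂₁ + t₂₂ * x.2)) ++
      b'.map fun x => (1, x.2))) (by
    intro x hx
    by_contra! h0
    simp only [List.mem_cons, List.mem_append, List.mem_map] at hx
    rcases hx with rfl | ⟨y, hy, rfl⟩ | ⟨y, hy, rfl⟩
    · obtain ⟨h1, h2⟩ := h0
      simp only at h1 h2
      exact hdet (by rw [h1, h2]; ring)
    · obtain ⟨h1, h2⟩ := h0
      simp only at h1 h2
      apply hdet
      have h3 : t₁₁ = -(t₁₂ * y.2) := by linear_combination h1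
      have h4 : t₂₁ = -(t₂₂ * y.2) := by linear_combination h2
      rw [h3, h4]; ring
    · exact one_ne_zero h0.1)
  have hc : ∀ i, t₁₁ - μ i * t₂₁ ≠ 0 := fun i => hμ i (t₁₁, t₂₁) (by simp)
  have hb : ∀ i, ∀ x ∈ b, (t₁₁ + t₁₂ * x.2) - μ i * (t₂₁ + t₂₂ * x.2) ≠ 0 := fun i x hx =>
    hμ i (t₁₁ + t₁₂ * x.2, t₂₁ + t₂₂ * x.2) (by
      simp only [List.mem_cons, List.mem_append, List.mem_map]
      exact Or.inr (Or.inl ⟨x, hx, rfl⟩))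
  have hb' : ∀ i, ∀ x ∈ b', 1 - μ i * x.2 ≠ 0 := fun i x hx =>
    hμ i (1, x.2) (by
      simp only [List.mem_cons, List.mem_append, List.mem_map]
      exact Or.inr (Or.inr ⟨x, hx, rfl⟩))
  let ν : Fin n → ℂ := fun i => -(t₁₂ - μ i * t₂₂) / (t₁₁ - μ i * t₂₁)
  have hνμ : ∀ i, ν i * (t₁₁ - μ i * t₂₁) = -(t₁₂ - μ i * t₂₂) := fun i =>
    div_mul_cancel₀ _ (hc i)
  have hν : Function.Injective ν := by
    intro i j hij
    have h1 := hνμ i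
    have h2 := hνμ j
    rw [← hij] at h2
    have h3 : (μ i - μ j) * (t₁₁ * t₂₂ - t₁₂ * t₂₁) = 0 := by
      linear_combination (t₁₁ - μ i * t₂₁) * h2 - (t₁₁ - μ j * t₂₁) * h1
    have h4 := (mul_eq_zero.1 h3).resolve_right hdet
    exact Fin.val_injective (hinj (sub_eq_zero.1 h4))
  have hker : ∀ i : Fin n, LinearMap.ker (f - ν i • g) =
      LinearMap.ker ((t₁₁ • f + t₁₂ • g) - μ i • (t₂₁ • f + t₂₂ • g)) := by
    intro i
    have : (t₁₁ • f + t₁₂ • g) - μ i • (t₂₁ • f + t₂₂ • g) =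
        (t₁₁ - μ i * t₂₁) • (f - ν i • g) := by
      rw [smul_sub, smul_smul, mul_comm _ (ν i), hνμ]
      module
    rw [this, LinearMap.ker_smul _ _ (hc i)]
  rw [← h.finrank_iSup_ker ν hν, ← h'.finrank_iSup_ker (fun i : Fin n => μ i)
    (hinj.comp Fin.val_injective) fun i => hb' i]
  · rw [iSup_congr hker]
  · intro i x hx h0
    apply hb i x hx
    linear_combination (t₁₁ - μ i * t₂₁) * h0 + x.2 * hνμ i

theorem KroneckerCoords.steps_eq : r₀ = r₀' ∧ L = L' := by
  have key := KroneckerCoords.sum_take_eq t₁₁ t₁₂ t₂₁ t₂₂ hdet h h'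
  -- The base width is compared separately: it may be zero, while zero entries at the end of a list
  -- would be invisible to partial sums.
  have h0 : r₀ = r₀' := by simpa using key 1
  refine ⟨h0, eq_of_sum_take_eq L L' h.steps_pos h'.steps_pos fun n => ?_⟩
  simpa [h0] using key (n + 1)

end Transform

end Uniqueness

/-! ### Invariance of the Jordan blocks -/

section Eigenvalues

variable {V W : Type*} [AddCommGroup V] [Module ℂ V] [AddCommGroup W] [Module ℂ W]
  {f g : V →ₗ[ℂ] W} {b : List (ℕ × ℂ)} {r₀ : ℕ} {L : List ℕ}

/-- The iterated images of the whole space under the relation `h ∘ f⁻¹`. -/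
def imageIter (f h : V →ₗ[ℂ] W) : ℕ → Submodule ℂ W
  | 0 => ⊤
  | k + 1 => ((imageIter f h k).comap f).map h

/-- The staircase component stays everything, because every nonzero combination of its two blocks is
surjective. On the Jordan component the relation is X A⁻¹ with A and X commuting, so its k-th image
is the range of X^k. -/
theorem KroneckerCoords.imageIter_eq (c : KroneckerCoords f g b r₀ L) (α₁ β₁ α β : ℂ)
    (h : α ≠ 0 ∨ β ≠ 0)
    (hu : IsUnit (α₁ • (1 : Matrix (Fin (jordanSize b)) (Fin (jordanSize b)) ℂ) +
      β₁ • jordanMatrix b)) (k : ℕ) :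
    imageIter (α₁ • f + β₁ • g) (α • f + β • g) k =
      ((LinearMap.range ((α • (1 : Matrix (Fin (jordanSize b)) (Fin (jordanSize b)) ℂ) +
        β • jordanMatrix b) ^ k).mulVecLin).prod ⊤).map c.tgt.toLinearMap := by
  set A := α₁ • (1 : Matrix (Fin (jordanSize b)) (Fin (jordanSize b)) ℂ) + β₁ • jordanMatrix b
    with hA
  set X := α • (1 : Matrix (Fin (jordanSize b)) (Fin (jordanSize b)) ℂ) + β • jordanMatrix b
    with hX
  have hcomm : Commute A X := by
    simp only [hA, hX, Commute, SemiconjBy, add_mul, mul_add, smul_mul_assoc, mul_smul_comm,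
      one_mul, mul_one]
    module
  induction k with
  | zero =>
    rw [eq_comm, imageIter, eq_top_iff]
    intro y _
    obtain ⟨p, rfl⟩ := c.tgt.surjective y
    exact ⟨p, ⟨⟨p.1, by simp⟩, trivial⟩, rfl⟩
  | succ k ih =>
    rw [imageIter, ih]
    apply le_antisymm
    · rintro _ ⟨x, hx, rfl⟩
      obtain ⟨p, rfl⟩ := c.src.surjective x
      obtain ⟨q, ⟨⟨a, ha⟩, -⟩, hq⟩ := hx
      rw [c.map_combination] at hq ⊢
      refine ⟨_, ⟨?_, trivial⟩, rfl⟩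
      have h1 : A *ᵥ p.1 = X ^ k *ᵥ a :=
        (Prod.ext_iff.1 (c.tgt.injective hq)).1.symm.trans ha.symm
      obtain ⟨a', rfl⟩ := Matrix.mulVec_surjective_iff_isUnit.2 hu a
      have h2 : p.1 = X ^ k *ᵥ a' := by
        refine Matrix.mulVec_injective_iff_isUnit.2 hu (h1.trans ?_)
        rw [Matrix.mulVec_mulVec, Matrix.mulVec_mulVec, (hcomm.pow_right k).eq]
      refine ⟨a', ?_⟩
      rw [Matrix.mulVecLin_apply, h2, Matrix.mulVec_mulVec, ← pow_succ']
    · rintro _ ⟨⟨_, y⟩, ⟨⟨a, rfl⟩, -⟩, rfl⟩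
      obtain ⟨z, hz⟩ := stair_surjective L r₀ c.steps_desc α β h y
      refine ⟨c.src (X ^ k *ᵥ a, z), ?_, ?_⟩
      · rw [SetLike.mem_coe, Submodule.mem_comap, c.map_combination]
        refine ⟨_, ⟨⟨A *ᵥ a, ?_⟩, trivial⟩, rfl⟩
        rw [Matrix.mulVecLin_apply, Matrix.mulVec_mulVec, Matrix.mulVec_mulVec,
          (hcomm.pow_right k).eq]
      · rw [c.map_combination]
        refine congrArg c.tgt (Prod.ext ?_ hz)
        rw [Matrix.mulVecLin_apply, Matrix.mulVec_mulVec, ← pow_succ']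

/-- The codimension is the nullity of (α + βJ)^k, to which a block of size m contributes min(m, k)
if its eigenvalue is a root and nothing otherwise. -/
theorem KroneckerCoords.finrank_imageIter (c : KroneckerCoords f g b r₀ L) (α₁ β₁ α β : ℂ)
    (h : α ≠ 0 ∨ β ≠ 0)
    (hu : IsUnit (α₁ • (1 : Matrix (Fin (jordanSize b)) (Fin (jordanSize b)) ℂ) +
      β₁ • jordanMatrix b)) (k : ℕ) :
    Module.finrank ℂ (imageIter (α₁ • f + β₁ • g) (α • f + β • g) k) +
      (b.map fun x => if α + β * x.2 = 0 then min x.1 k else 0).sum = Module.finrank ℂ W := by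
  rw [c.imageIter_eq α₁ β₁ α β h hu k]
  have h1 := c.tgt.finrank_map_eq ((LinearMap.range
    ((α • (1 : Matrix (Fin (jordanSize b)) (Fin (jordanSize b)) ℂ) +
      β • jordanMatrix b) ^ k).mulVecLin).prod ⊤)
  set R := LinearMap.range ((α • (1 : Matrix (Fin (jordanSize b)) (Fin (jordanSize b)) ℂ) +
      β • jordanMatrix b) ^ k).mulVecLin
  have h0 : Module.finrank ℂ (R.prod (⊤ : Submodule ℂ (Fin (stairRows L) → ℂ))) =
      Module.finrank ℂ (Fin (stairRows L) → ℂ) + Module.finrank ℂ R :=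
    finrank_eq_add_of_map_snd _ R (fun y => ⟨0, R.zero_mem, trivial⟩)
      (fun x => and_iff_left trivial)
  rw [h0, Module.finrank_fin_fun] at h1
  have h2 := rank_smul_one_add_jordanMatrix_pow b α β h k
  change Module.finrank ℂ R = _ at h2
  have h3 := c.tgt.finrank_eq
  rw [Module.finrank_prod, Module.finrank_fin_fun, Module.finrank_fin_fun, jordanSize_eq_sum] at h3
  have h4 : (b.map fun x => if α + β * x.2 = 0 then x.1 - k else x.1).sum +
      (b.map fun x => if α + β * x.2 = 0 then min x.1 k else 0).sum = (b.map Prod.fst).sum := by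
    rw [← List.sum_map_add]
    congr 1
    refine List.map_congr_left fun x _ => ?_
    split_ifs <;> omega
  refine (congrArg (· + _) h1).trans ?_
  omega

/-- The number of blocks of size m + 1 is minus the second difference of k ↦ Σ min(size, k) at m +
1, written without subtraction. -/
theorem count_jordanBlocks (b : List (ℕ × ℂ)) (z : ℂ) (m : ℕ) [DecidableEq (ℕ × ℂ)] :
    b.count (m + 1, z) + (b.map fun x => if x.2 = z then min x.1 m else 0).sum +
        (b.map fun x => if x.2 = z then min x.1 (m + 2) else 0).sum =
      2 * (b.map fun x => if x.2 = z then min x.1 (m + 1) else 0).sum := by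
  induction b with
  | nil => simp
  | cons x b ih =>
    obtain ⟨n, w⟩ := x
    simp only [List.count_cons, List.map_cons, List.sum_cons, beq_iff_eq, Prod.mk.injEq]
    by_cases hw : w = z
    · by_cases hn : n = m + 1
      · simp only [hw, hn, and_self, if_true]
        omega
      · simp only [hw, hn, false_and, if_true, if_false]
        omega
    · simp only [hw, and_false, if_false]
      omega

theorem perm_of_nullities_eq (b b' : List (ℕ × ℂ)) (hb : ∀ x ∈ b, 0 < x.1)
    (hb' : ∀ x ∈ b', 0 < x.1)
    (h : ∀ (z : ℂ) (k : ℕ), (b.map fun x => if x.2 = z then min x.1 k else 0).sum =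
      (b'.map fun x => if x.2 = z then min x.1 k else 0).sum) : b.Perm b' := by
  classical
  rw [List.perm_iff_count]
  rintro ⟨n, z⟩
  cases n with
  | zero =>
    rw [List.count_eq_zero_of_not_mem fun hx => absurd (hb _ hx) (lt_irrefl 0),
      List.count_eq_zero_of_not_mem fun hx => absurd (hb' _ hx) (lt_irrefl 0)]
  | succ m =>
    have h1 := count_jordanBlocks b z m
    have h2 := count_jordanBlocks b' z m
    have := h z m
    have := h z (m + 1)
    have := h z (m + 2)
    omega

/-- The iterated images depend only on the linear maps, so their codimensions can be computed in
either system of coordinates. Equating the two results for all z and k matches the blocks. -/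
theorem KroneckerCoords.blocks_perm {b' : List (ℕ × ℂ)} {r₀' : ℕ} {L' : List ℕ}
    (t₁₁ t₁₂ t₂₁ t₂₂ : ℂ) (hdet : t₁₁ * t₂₂ - t₁₂ * t₂₁ ≠ 0) (c : KroneckerCoords f g b r₀ L)
    (c' : KroneckerCoords (t₁₁ • f + t₁₂ • g) (t₂₁ • f + t₂₂ • g) b' r₀' L') :
    (∀ x ∈ b, t₁₁ + t₁₂ * x.2 ≠ 0) ∧
      (b.map fun x => (x.1, (t₂₁ + t₂₂ * x.2) / (t₁₁ + t₁₂ * x.2))).Perm b' := by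
  have h₁ : t₁₁ ≠ 0 ∨ t₁₂ ≠ 0 := by
    by_contra! h0
    exact hdet (by rw [h0.1, h0.2]; ring)
  have hu := c.isUnit_of_surjective t₁₁ t₁₂ c'.surjective_fst
  have hne := ne_zero_of_isUnit_smul_one_add_jordanMatrix b c.blocks_pos t₁₁ t₁₂ h₁ hu
  refine ⟨hne, perm_of_nullities_eq _ _ ?_ c'.blocks_pos fun z k => ?_⟩
  · intro x hx
    obtain ⟨y, hy, rfl⟩ := List.mem_map.1 hx
    exact c.blocks_pos y hy
  -- These are the coefficients of g' - z f' in terms of f and g, where f' and g' are the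
  -- transformed maps; at λ they vanish exactly when the Möbius image of λ is z.
  have h : t₂₁ - z * t₁₁ ≠ 0 ∨ t₂₂ - z * t₁₂ ≠ 0 := by
    by_contra! h0
    apply hdet
    linear_combination t₁₁ * h0.2 - t₁₂ * h0.1
  have e1 := c.finrank_imageIter t₁₁ t₁₂ (t₂₁ - z * t₁₁) (t₂₂ - z * t₁₂) h hu k
  have e2 := c'.finrank_imageIter 1 0 (-z) 1 (Or.inr one_ne_zero)
    (by simp) k
  have hf : (1 : ℂ) • (t₁₁ • f + t₁₂ • g) + (0 : ℂ) • (t₂₁ • f + t₂₂ • g) =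
      t₁₁ • f + t₁₂ • g := by simp
  have hg : (-z) • (t₁₁ • f + t₁₂ • g) + (1 : ℂ) • (t₂₁ • f + t₂₂ • g) =
      (t₂₁ - z * t₁₁) • f + (t₂₂ - z * t₁₂) • g := by module
  rw [hf, hg, ← e1] at e2
  have e3 := (Nat.add_left_cancel e2).symm
  rw [List.map_map]
  refine Eq.trans ?_ (e3.trans ?_)
  · congr 1
    refine List.map_congr_left fun x hx => ?_
    simp only [Function.comp_apply]
    refine if_congr ?_ rfl rfl
    rw [div_eq_iff (hne x hx), ← sub_eq_zero]
    constructor <;> intro h0 <;> linear_combination h0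
  · congr 1
    refine List.map_congr_left fun x hx => if_congr ?_ rfl rfl
    rw [one_mul, neg_add_eq_zero, eq_comm]

end Eigenvalues

/-! ### Transport and relabelling of coordinates -/

namespace KroneckerCoords

variable {V W : Type*} [AddCommGroup V] [Module ℂ V] [AddCommGroup W] [Module ℂ W]
  {f g : V →ₗ[ℂ] W} {b : List (ℕ × ℂ)} {r₀ : ℕ} {L : List ℕ}

/-- The coordinates with respect to a Kronecker basis. -/
noncomputable def ofBasis
    {v : Module.Basis (Fin (jordanSize b) ⊕ Fin (stairRows L + r₀)) ℂ V}
    {w : Module.Basis (Fin (jordanSize b) ⊕ Fin (stairRows L)) ℂ W}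
    (h : IsKroneckerBasis f g b r₀ L v w) : KroneckerCoords f g b r₀ L where
  src := (LinearEquiv.sumArrowLequivProdArrow _ _ ℂ ℂ).symm.trans v.equivFun.symm
  tgt := (LinearEquiv.sumArrowLequivProdArrow _ _ ℂ ℂ).symm.trans w.equivFun.symm
  blocks_pos := h.blocks_pos
  steps_pos := h.steps_pos
  steps_desc := h.steps_desc
  map_fst p := by
    simp [Module.Basis.equivFun_symm_apply, Fintype.sum_sum_type, Fin.sum_univ_add, h.fst_inl,
      h.fst_castAdd, h.fst_natAdd, LinearEquiv.sumArrowLequivProdArrow]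
    rfl
  map_snd p := by
    simp only [LinearEquiv.trans_apply, Module.Basis.equivFun_symm_apply, Fintype.sum_sum_type,
      LinearEquiv.sumArrowLequivProdArrow, LinearEquiv.coe_symm_mk', map_add, map_sum, map_smul,
      h.snd_inl, h.snd_inr, Finset.smul_sum, smul_smul]
    congr 1
    · rw [Finset.sum_comm]
      simp [Matrix.mulVec, dotProduct, Finset.sum_smul, mul_comm]
      rfl
    · rw [Finset.sum_comm]
      simp [Matrix.mulVec, dotProduct, Finset.sum_smul, mul_comm]
      rfl

/-- Transport of coordinates along linear equivalences. -/
noncomputable def congr {V' W' : Type*} [AddCommGroup V'] [Module ℂ V'] [AddCommGroup W']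
    [Module ℂ W'] {f' g' : V' →ₗ[ℂ] W'} (c : KroneckerCoords f g b r₀ L) (eV : V ≃ₗ[ℂ] V')
    (eW : W ≃ₗ[ℂ] W') (hf : ∀ x, f' (eV x) = eW (f x)) (hg : ∀ x, g' (eV x) = eW (g x)) :
    KroneckerCoords f' g' b r₀ L where
  src := c.src.trans eV
  tgt := c.tgt.trans eW
  blocks_pos := c.blocks_pos
  steps_pos := c.steps_pos
  steps_desc := c.steps_desc
  map_fst p := by simp [hf, c.map_fst]
  map_snd p := by simp [hg, c.map_snd]

/-- Relabelling of the Jordan blocks. -/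
noncomputable def permute {b' : List (ℕ × ℂ)} (c : KroneckerCoords f g b r₀ L) (hb : b.Perm b')
    (σ : Fin (jordanSize b) ≃ Fin (jordanSize b'))
    (hσ : jordanMatrix b = (jordanMatrix b').submatrix σ σ) : KroneckerCoords f g b' r₀ L where
  src := ((LinearEquiv.funCongrLeft ℂ ℂ σ).prodCongr (LinearEquiv.refl ℂ _)).trans c.src
  tgt := ((LinearEquiv.funCongrLeft ℂ ℂ σ).prodCongr (LinearEquiv.refl ℂ _)).trans c.tgt
  blocks_pos x hx := c.blocks_pos x (hb.mem_iff.2 hx)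
  steps_pos := c.steps_pos
  steps_desc := c.steps_desc
  map_fst p := by
    rw [LinearEquiv.trans_apply, c.map_fst]
    rfl
  map_snd p := by
    rw [LinearEquiv.trans_apply, c.map_snd, LinearEquiv.trans_apply]
    refine congrArg c.tgt (Prod.ext ?_ rfl)
    rw [hσ]
    refine (Matrix.submatrix_mulVec_equiv (jordanMatrix b') _ σ σ).trans ?_
    simp [LinearEquiv.funCongrLeft_apply, LinearMap.funLeft, Function.comp_assoc]

end KroneckerCoords

theorem exists_jordanMatrix_submatrix {b b' : List (ℕ × ℂ)} (h : b.Perm b') :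
    ∃ σ : Fin (jordanSize b) ≃ Fin (jordanSize b'),
      jordanMatrix b = (jordanMatrix b').submatrix σ σ := by
  induction h with
  | nil => exact ⟨Equiv.refl _, rfl⟩
  | cons x _ ih =>
    obtain ⟨σ, hσ⟩ := ih
    refine ⟨finSumFinEquiv.symm.trans (((Equiv.refl _).sumCongr σ).trans finSumFinEquiv), ?_⟩
    ext i j
    obtain ⟨i, rfl⟩ := finSumFinEquiv.surjective i
    obtain ⟨j, rfl⟩ := finSumFinEquiv.surjective j
    refine (diagSum_apply _ _ i j).trans (Eq.trans ?_ (diagSum_apply _ _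
      (((Equiv.refl _).sumCongr σ) (finSumFinEquiv.symm (finSumFinEquiv i)))
      (((Equiv.refl _).sumCongr σ) (finSumFinEquiv.symm (finSumFinEquiv j)))).symm)
    rw [Equiv.symm_apply_apply, Equiv.symm_apply_apply, hσ]
    rcases i with i | i <;> rcases j with j | j <;> rfl
  | swap x y l =>
    let τ : Fin y.1 ⊕ (Fin x.1 ⊕ Fin (jordanSize l)) ≃ Fin x.1 ⊕ (Fin y.1 ⊕ Fin (jordanSize l)) :=
      (Equiv.sumAssoc _ _ _).symm.trans (((Equiv.sumComm _ _).sumCongr (Equiv.refl _)).trans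
        (Equiv.sumAssoc _ _ _))
    let e : ∀ x y : ℕ × ℂ, Fin x.1 ⊕ (Fin y.1 ⊕ Fin (jordanSize l)) ≃
        Fin (jordanSize (x :: y :: l)) := fun x y =>
      ((Equiv.refl _).sumCongr finSumFinEquiv).trans finSumFinEquiv
    have he : ∀ (x y : ℕ × ℂ) i j, jordanMatrix (x :: y :: l) (e x y i) (e x y j) =
        Matrix.fromBlocks (jordanBlock x.1 x.2) 0 0
          (Matrix.fromBlocks (jordanBlock y.1 y.2) 0 0 (jordanMatrix l)) i j := by
      intro x y i j
      refine (diagSum_apply _ _ (((Equiv.refl _).sumCongr finSumFinEquiv) i)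
        (((Equiv.refl _).sumCongr finSumFinEquiv) j)).trans ?_
      rcases i with i | i <;> rcases j with j | j
      · rfl
      · rfl
      · rfl
      · exact diagSum_apply _ _ i j
    refine ⟨(e y x).symm.trans (τ.trans (e x y)), ?_⟩
    ext i j
    obtain ⟨i, rfl⟩ := (e y x).surjective i
    obtain ⟨j, rfl⟩ := (e y x).surjective j
    simp only [Matrix.submatrix_apply, Equiv.trans_apply, Equiv.symm_apply_apply, he]
    rcases i with i | i | i <;> rcases j with j | j | j <;> rfl
  | trans _ _ ih₁ ih₂ =>
    obtain ⟨σ, hσ⟩ := ih₁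
    obtain ⟨τ, hτ⟩ := ih₂
    exact ⟨σ.trans τ, by rw [hσ, hτ]; rfl⟩

theorem stairIdentity_mulVec (r₀ : ℕ) (L : List ℕ) (x : Fin (stairRows L + r₀) → ℂ) :
    stairIdentity r₀ L *ᵥ x = fun i => x (Fin.castAdd r₀ i) := by
  ext i
  rw [Matrix.mulVec, dotProduct, Finset.sum_eq_single (Fin.castAdd r₀ i)]
  · simp [stairIdentity]
  · intro j _ hj
    rw [stairIdentity, Matrix.of_apply, if_neg, zero_mul]
    exact fun h => hj (Fin.ext h.symm)
  · simp

/-- The coordinates of a normal form. -/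
theorem NormalFormData.Represents.nonempty_coords {d : NormalFormData} {M N : ℕ}
    {Ω : MatrixPair M N} (h : d.Represents Ω) :
    Nonempty (KroneckerCoords (Matrix.toLin' (Ω 0)) (Matrix.toLin' (Ω 1)) d.blocks d.base
      d.steps) := by
  obtain ⟨hM, hN, hΩ⟩ := h
  subst hM hN
  have h0 : Ω 0 = d.pair 0 := hΩ 0
  have h1 : Ω 1 = d.pair 1 := hΩ 1
  refine ⟨⟨appendEquiv _ _, appendEquiv _ _, d.blocks_pos, d.steps_pos, d.steps_desc,
    fun p => ?_, fun p => ?_⟩⟩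
  · rw [Matrix.toLin'_apply, h0]
    refine (diagSum_mulVec_appendEquiv _ _ p).trans ?_
    rw [Matrix.one_mulVec, stairIdentity_mulVec]
    rfl
  · rw [Matrix.toLin'_apply, h1]
    exact diagSum_mulVec_appendEquiv _ _ p

/-! ### Local operators and strict equivalence -/

section LocalAction

variable {M N : ℕ}

theorem localAction_mul (T T' : Matrix (Fin 2) (Fin 2) ℂ) (P P' : Matrix (Fin M) (Fin M) ℂ)
    (Q Q' : Matrix (Fin N) (Fin N) ℂ) (Γ : MatrixPair M N) :
    localAction T P Q (localAction T' P' Q' Γ) = localAction (T * T') (P * P') (Q' * Q) Γ := by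
  funext i
  simp only [localAction, Matrix.mul_add, Matrix.add_mul, Matrix.mul_smul, Matrix.smul_mul,
    Matrix.mul_apply, Fin.sum_univ_two, Matrix.mul_assoc]
  module

theorem localAction_one (Γ : MatrixPair M N) : localAction 1 1 1 Γ = Γ := by
  funext i
  obtain rfl | rfl : i = 0 ∨ i = 1 := by omega
  all_goals simp [localAction]

namespace SLOCCEquiv

variable {Γ Δ Ω : MatrixPair M N}

theorem trans (h : SLOCCEquiv Γ Δ) (h' : SLOCCEquiv Δ Ω) : SLOCCEquiv Γ Ω := by
  obtain ⟨T, P, Q, rfl⟩ := h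
  obtain ⟨T', P', Q', rfl⟩ := h'
  exact ⟨T' * T, P' * P, Q * Q', by rw [localAction_mul]; rfl⟩

theorem symm (h : SLOCCEquiv Γ Δ) : SLOCCEquiv Δ Γ := by
  obtain ⟨T, P, Q, rfl⟩ := h
  refine ⟨T⁻¹, P⁻¹, Q⁻¹, ?_⟩
  rw [localAction_mul, ← Units.val_mul, ← Units.val_mul, ← Units.val_mul, inv_mul_cancel,
    inv_mul_cancel, mul_inv_cancel]
  exact (localAction_one Γ).symm

end SLOCCEquiv

theorem rank_mul_mul_of_units (P : GL (Fin M) ℂ) (Q : GL (Fin N) ℂ)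
    (A : Matrix (Fin M) (Fin N) ℂ) : (P.val * A * Q.val).rank = A.rank := by
  have hP : IsUnit P.val.det := (Matrix.isUnit_iff_isUnit_det _).1 P.isUnit
  have hQ : IsUnit Q.val.det := (Matrix.isUnit_iff_isUnit_det _).1 Q.isUnit
  rw [Matrix.rank_mul_eq_left_of_isUnit_det _ _ hQ, Matrix.rank_mul_eq_right_of_isUnit_det _ _ hP]

theorem localAction_apply (T : Matrix (Fin 2) (Fin 2) ℂ) (P : Matrix (Fin M) (Fin M) ℂ)
    (Q : Matrix (Fin N) (Fin N) ℂ) (Γ : MatrixPair M N) (i : Fin 2) :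
    localAction T P Q Γ i = P * (T i 0 • Γ 0 + T i 1 • Γ 1) * Q := by
  simp [localAction, Matrix.mul_add, Matrix.add_mul]

theorem pencilRanks_localAction_subset (T : GL (Fin 2) ℂ) (P : GL (Fin M) ℂ) (Q : GL (Fin N) ℂ)
    (Γ : MatrixPair M N) : pencilRanks (localAction T.val P.val Q.val Γ) ⊆ pencilRanks Γ := by
  rintro r ⟨α, β, h, rfl⟩
  have hdet : T.val 0 0 * T.val 1 1 - T.val 0 1 * T.val 1 0 ≠ 0 := by
    rw [← Matrix.det_fin_two]
    exact ((Matrix.isUnit_iff_isUnit_det _).1 T.isUnit).ne_zero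
  refine ⟨α * T.val 0 0 + β * T.val 1 0, α * T.val 0 1 + β * T.val 1 1, ?_, ?_⟩
  · intro h0
    obtain ⟨h1, h2⟩ := Prod.mk.inj h0
    apply h
    rw [Prod.mk.injEq]
    constructor <;> refine (mul_eq_zero.1 ?_).resolve_right hdet
    · linear_combination T.val 1 1 * h1 - T.val 1 0 * h2
    · linear_combination T.val 0 0 * h2 - T.val 0 1 * h1
  · rw [← rank_mul_mul_of_units P Q, localAction_apply, localAction_apply]
    congr 1
    simp only [Matrix.mul_add, Matrix.add_mul, Matrix.mul_smul, Matrix.smul_mul]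
    module

theorem SLOCCEquiv.pencilRanks_subset {Γ Δ : MatrixPair M N} (h : SLOCCEquiv Γ Δ) :
    pencilRanks Δ ⊆ pencilRanks Γ := by
  obtain ⟨T, P, Q, rfl⟩ := h
  exact pencilRanks_localAction_subset T P Q Γ

theorem SLOCCEquiv.mem_rankClass {Γ Δ : MatrixPair M N} {n l : ℕ} (h : SLOCCEquiv Γ Δ)
    (hΓ : Γ ∈ rankClass M N n l) : Δ ∈ rankClass M N n l := by
  have : pencilRanks Δ = pencilRanks Γ :=
    h.pencilRanks_subset.antisymm h.symm.pencilRanks_subset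
  simpa only [rankClass, Set.mem_ofPred_eq, this] using hΓ

/-- The maximal and the minimal rank of a pencil are taken by the two components of an equivalent
pair. -/
theorem exists_localAction_rank {Γ : MatrixPair M N} {n l : ℕ} (hΓ : Γ ∈ rankClass M N n l) :
    ∃ T : GL (Fin 2) ℂ, (T.val 0 0 • Γ 0 + T.val 0 1 • Γ 1).rank = n ∧
      (T.val 1 0 • Γ 0 + T.val 1 1 • Γ 1).rank = l := by
  obtain ⟨⟨⟨α, β, hαβ, hn⟩, hmax⟩, ⟨α', β', hαβ', hl⟩, hmin⟩ := hΓ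
  suffices h : ∃ γ δ : ℂ, α * δ - β * γ ≠ 0 ∧ (γ • Γ 0 + δ • Γ 1).rank = l by
    obtain ⟨γ, δ, hdet, hr⟩ := h
    refine ⟨Matrix.GeneralLinearGroup.mkOfDetNeZero !![α, β; γ, δ] ?_, ?_, ?_⟩
    · rwa [Matrix.det_fin_two_of]
    · simpa [Matrix.GeneralLinearGroup.mkOfDetNeZero] using hn
    · simpa [Matrix.GeneralLinearGroup.mkOfDetNeZero] using hr
  by_cases hdet : α * β' - β * α' = 0
  -- If the two parameter vectors are proportional, the extreme ranks coincide, the rank is constant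
  -- on the pencil, and any independent second row of T will do.
  · have hnl : n = l := by
      by_cases hα : α = 0
      · have hβ : β ≠ 0 := fun h => hαβ (by rw [hα, h])
        have hα' : α' = 0 := by
          simpa [hα, hβ] using hdet
        have hβ' : β' ≠ 0 := fun h => hαβ' (by rw [hα', h])
        rw [← hn, ← hl, hα, hα', zero_smul, zero_add, zero_add,
          Matrix.rank_smul_of_mem_nonZeroDivisors _ (mem_nonZeroDivisors_of_ne_zero hβ),
          Matrix.rank_smul_of_mem_nonZeroDivisors _ (mem_nonZeroDivisors_of_ne_zero hβ')]
      · have hα' : α' ≠ 0 := by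
          intro h
          have : β' = 0 := by simpa [h, hα] using hdet
          exact hαβ' (by rw [h, this])
        have : α' • Γ 0 + β' • Γ 1 = (α' / α) • (α • Γ 0 + β • Γ 1) := by
          have h1 : α' / α * α = α' := div_mul_cancel₀ _ hα
          have h2 : α' / α * β = β' := by
            field_simp
            linear_combination -hdet
          rw [smul_add, smul_smul, smul_smul, h1, h2]
        rw [← hn, ← hl, this, Matrix.rank_smul_of_mem_nonZeroDivisors _
          (mem_nonZeroDivisors_of_ne_zero (div_ne_zero hα' hα))]
    have hall : ∀ γ δ : ℂ, (γ, δ) ≠ (0, 0) → (γ • Γ 0 + δ • Γ 1).rank = l := fun γ δ h =>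
      le_antisymm (hnl ▸ hmax ⟨γ, δ, h, rfl⟩) (hmin ⟨γ, δ, h, rfl⟩)
    by_cases hα : α = 0
    · have hβ : β ≠ 0 := fun h => hαβ (by rw [hα, h])
      exact ⟨1, 0, by simpa using hβ, hall 1 0 (by simp)⟩
    · exact ⟨0, 1, by simpa using hα, hall 0 1 (by simp)⟩
  · exact ⟨α', β', hdet, hl⟩

/-- Pairs with the same normal form are strictly equivalent. -/
theorem exists_strictEquiv {Γ Δ : MatrixPair M N} {b : List (ℕ × ℂ)} {r₀ : ℕ} {L : List ℕ}
    (c : KroneckerCoords (Matrix.toLin' (Γ 0)) (Matrix.toLin' (Γ 1)) b r₀ L)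
    (c' : KroneckerCoords (Matrix.toLin' (Δ 0)) (Matrix.toLin' (Δ 1)) b r₀ L) :
    ∃ (P : GL (Fin M) ℂ) (Q : GL (Fin N) ℂ), Δ = localAction 1 P.val Q.val Γ := by
  -- Matching the coordinates of both pairs gives Q on the source, from Δ to Γ, and P on the target,
  -- from Γ to Δ.
  let eV := c'.src.symm.trans c.src
  let eW := c.tgt.symm.trans c'.tgt
  have key : ∀ i x, Matrix.toLin' (Δ i) x = eW (Matrix.toLin' (Γ i) (eV x)) := by
    intro i x
    obtain ⟨p, rfl⟩ := c'.src.surjective x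
    fin_cases i
    · simp only [eV, eW, LinearEquiv.trans_apply, LinearEquiv.symm_apply_apply]
      exact (c'.map_fst p).trans (by rw [Fin.zero_eta, c.map_fst, LinearEquiv.symm_apply_apply])
    · simp only [eV, eW, LinearEquiv.trans_apply, LinearEquiv.symm_apply_apply]
      exact (c'.map_snd p).trans (by rw [Fin.mk_one, c.map_snd, LinearEquiv.symm_apply_apply])
  let P : GL (Fin M) ℂ := ⟨LinearMap.toMatrix' eW.toLinearMap, LinearMap.toMatrix' eW.symm.toLinearMap,
    by rw [← LinearMap.toMatrix'_comp]; simp, by rw [← LinearMap.toMatrix'_comp]; simp⟩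
  let Q : GL (Fin N) ℂ := ⟨LinearMap.toMatrix' eV.toLinearMap, LinearMap.toMatrix' eV.symm.toLinearMap,
    by rw [← LinearMap.toMatrix'_comp]; simp, by rw [← LinearMap.toMatrix'_comp]; simp⟩
  refine ⟨P, Q, funext fun i => ?_⟩
  have h1 : localAction 1 P.val Q.val Γ i = P.val * Γ i * Q.val := by
    obtain rfl | rfl : i = 0 ∨ i = 1 := by omega
    all_goals simp [localAction]
  rw [h1]
  apply Matrix.toLin'.injective
  refine LinearMap.ext fun x => ?_
  rw [key, Matrix.toLin'_mul, Matrix.toLin'_mul]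
  simp [P, Q]

theorem NormalFormData.exists_represents_of_coords {d : NormalFormData}
    {f g : (Fin N → ℂ) →ₗ[ℂ] (Fin M → ℂ)} (c : KroneckerCoords f g d.blocks d.base d.steps) :
    ∃ Ω : MatrixPair M N, d.Represents Ω := by
  have hM : d.rows = M := by
    have := c.tgt.finrank_eq
    rwa [Module.finrank_prod, Module.finrank_fin_fun, Module.finrank_fin_fun,
      Module.finrank_fin_fun] at this
  have hN : d.cols = N := by
    have := c.src.finrank_eq
    rwa [Module.finrank_prod, Module.finrank_fin_fun, Module.finrank_fin_fun,
      Module.finrank_fin_fun] at this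
  exact ⟨fun i => Matrix.reindex (finCongr hM) (finCongr hN) (d.pair i), hM, hN, fun _ => rfl⟩

/-- A pair with surjective first component is strictly equivalent to a normal form. -/
theorem exists_represents {Γ : MatrixPair M N}
    (hΓ : Function.Surjective (Matrix.toLin' (Γ 0))) :
    ∃ (d : NormalFormData) (Ω : MatrixPair M N) (P : GL (Fin M) ℂ) (Q : GL (Fin N) ℂ),
      d.Represents Ω ∧ Ω = localAction 1 P.val Q.val Γ := by
  obtain ⟨b, r₀, L, v, w, h⟩ := exists_isKroneckerBasis _ (Matrix.toLin' (Γ 1)) hΓ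
  let d : NormalFormData := ⟨b, r₀, L, h.blocks_pos, h.steps_pos, h.steps_desc⟩
  let c : KroneckerCoords (Matrix.toLin' (Γ 0)) (Matrix.toLin' (Γ 1)) d.blocks d.base d.steps :=
    KroneckerCoords.ofBasis h
  obtain ⟨Ω, hd⟩ := NormalFormData.exists_represents_of_coords c
  obtain ⟨c'⟩ := hd.nonempty_coords
  obtain ⟨P, Q, h⟩ := exists_strictEquiv c c'
  exact ⟨d, Ω, P, Q, hd, h⟩

theorem surjective_toLin'_of_rank_eq {A : Matrix (Fin M) (Fin N) ℂ} (h : A.rank = M) :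
    Function.Surjective (Matrix.toLin' A) := by
  refine LinearMap.range_eq_top.1 (Submodule.eq_top_of_finrank_eq ?_)
  rw [Module.finrank_fin_fun]
  exact h

theorem toLin'_localAction_one_one (T : Matrix (Fin 2) (Fin 2) ℂ) (Γ : MatrixPair M N)
    (i : Fin 2) : Matrix.toLin' (localAction T 1 1 Γ i) =
      T i 0 • Matrix.toLin' (Γ 0) + T i 1 • Matrix.toLin' (Γ 1) := by
  simp [localAction]

/-- The normal forms of equivalent pairs have the same steps and equivalent Jordan blocks. -/
theorem NormalFormData.eq_of_localAction {d d' : NormalFormData} {Ω Ω' : MatrixPair M N}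
    (hd : d.Represents Ω) (hd' : d'.Represents Ω') (T : GL (Fin 2) ℂ) (P : GL (Fin M) ℂ)
    (Q : GL (Fin N) ℂ) (h : Ω' = localAction T.val P.val Q.val Ω) :
    (d.base = d'.base ∧ d.steps = d'.steps) ∧
      (∀ x ∈ d.blocks, T.val 0 0 + T.val 0 1 * x.2 ≠ 0) ∧
      (d.blocks.map fun x =>
        (x.1, (T.val 1 0 + T.val 1 1 * x.2) / (T.val 0 0 + T.val 0 1 * x.2))).Perm d'.blocks := by
  obtain ⟨c⟩ := hd.nonempty_coords
  obtain ⟨c₁⟩ := hd'.nonempty_coords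
  have hdet : T.val 0 0 * T.val 1 1 - T.val 0 1 * T.val 1 0 ≠ 0 := by
    rw [← Matrix.det_fin_two]
    exact ((Matrix.isUnit_iff_isUnit_det _).1 T.isUnit).ne_zero
  -- Multiplication by Q on the source and by P⁻¹ on the target carries Ω' to the T-combinations of
  -- Ω, so both normal forms can be compared on the same spaces.
  let eV : (Fin N → ℂ) ≃ₗ[ℂ] (Fin N → ℂ) :=
    LinearEquiv.ofLinearMap (Matrix.toLin' Q.val) (Matrix.toLin' Q.inv)
      (by rw [← Matrix.toLin'_mul, Q.val_inv, Matrix.toLin'_one])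
      (by rw [← Matrix.toLin'_mul, Q.inv_val, Matrix.toLin'_one])
  let eW : (Fin M → ℂ) ≃ₗ[ℂ] (Fin M → ℂ) :=
    LinearEquiv.ofLinearMap (Matrix.toLin' P.inv) (Matrix.toLin' P.val)
      (by rw [← Matrix.toLin'_mul, P.inv_val, Matrix.toLin'_one])
      (by rw [← Matrix.toLin'_mul, P.val_inv, Matrix.toLin'_one])
  have key : ∀ i x, (T.val i 0 • Matrix.toLin' (Ω 0) + T.val i 1 • Matrix.toLin' (Ω 1)) (eV x) =
      eW (Matrix.toLin' (Ω' i) x) := by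
    intro i x
    have h1 : eW (Matrix.toLin' (Ω' i) x) = (P.inv * Ω' i) *ᵥ x := by
      rw [← Matrix.mulVec_mulVec, LinearEquiv.coe_ofLinearMap, Matrix.toLin'_apply,
        Matrix.toLin'_apply]
    have h2 : (T.val i 0 • Matrix.toLin' (Ω 0) + T.val i 1 • Matrix.toLin' (Ω 1)) (eV x) =
        ((T.val i 0 • Ω 0 + T.val i 1 • Ω 1) * Q.val) *ᵥ x := by
      rw [← map_smul, ← map_smul, ← map_add, ← Matrix.mulVec_mulVec, LinearEquiv.coe_ofLinearMap,
        Matrix.toLin'_apply, Matrix.toLin'_apply]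
    rw [h1, h2, h, localAction_apply, ← Matrix.mul_assoc, ← Matrix.mul_assoc, P.inv_val,
      Matrix.one_mul]
  let c' := c₁.congr eV eW (key 0) (key 1)
  exact ⟨KroneckerCoords.steps_eq _ _ _ _ hdet c c', KroneckerCoords.blocks_perm _ _ _ _ hdet c c'⟩

end LocalAction

/-! ### The classification -/

theorem theorem1 (M N l : ℕ) :
    -- every pair in `C_{M,l}` is SLOCC equivalent to a normal form, with `r(Γ₁) = M`, `r(Γ₂) = l`
    (∀ Γ ∈ rankClass M N M l, ∃ Ω ∈ normalFormSet M N l,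
      SLOCCEquiv Γ Ω ∧ (Ω 0).rank = M ∧ (Ω 1).rank = l) ∧
    -- two pairs are SLOCC equivalent iff they can be transformed into the same normal form
    (∀ Γ ∈ rankClass M N M l, ∀ Δ ∈ rankClass M N M l,
      (SLOCCEquiv Γ Δ ↔ ∃ Ω ∈ normalFormSet M N l, SLOCCEquiv Γ Ω ∧ SLOCCEquiv Δ Ω)) ∧
    -- two normal forms are SLOCC equivalent iff they have the same `E₂` and equivalent `J`
    (∀ Ω ∈ normalFormSet M N l, ∀ Ω' ∈ normalFormSet M N l, ∀ d d' : NormalFormData,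
      d.Represents Ω → d'.Represents Ω' →
      (SLOCCEquiv Ω Ω' ↔
        (d.base = d'.base ∧ d.steps = d'.steps) ∧ JordanEquiv d.blocks d'.blocks)) := by
  have hex : ∀ Γ ∈ rankClass M N M l, ∃ Ω ∈ normalFormSet M N l,
      SLOCCEquiv Γ Ω ∧ (Ω 0).rank = M ∧ (Ω 1).rank = l := by
    intro Γ hΓ
    obtain ⟨T, h0, h1⟩ := exists_localAction_rank hΓ
    have hr : ∀ i, localAction T.val 1 1 Γ i = T.val i 0 • Γ 0 + T.val i 1 • Γ 1 := fun i => by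
      simp [localAction]
    obtain ⟨d, Ω, P, Q, hd, hΩ⟩ := exists_represents (Γ := localAction T.val 1 1 Γ)
      (surjective_toLin'_of_rank_eq (by rw [hr, h0]))
    rw [localAction_mul, Matrix.one_mul, Matrix.mul_one, Matrix.one_mul] at hΩ
    have hequiv : SLOCCEquiv Γ Ω := ⟨T, P, Q, hΩ⟩
    refine ⟨Ω, ⟨hequiv.mem_rankClass hΓ, d, hd⟩, hequiv, ?_, ?_⟩
    · rw [hΩ, localAction_apply, rank_mul_mul_of_units, h0]
    · rw [hΩ, localAction_apply, rank_mul_mul_of_units, h1]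
  refine ⟨hex, fun Γ hΓ Δ hΔ => ⟨fun h => ?_, ?_⟩, fun Ω hΩ Ω' hΩ' d d' hd hd' => ⟨?_, ?_⟩⟩
  · obtain ⟨Ω, hΩ, hΔΩ, -⟩ := hex Δ hΔ
    exact ⟨Ω, hΩ, h.trans hΔΩ, hΔΩ⟩
  · rintro ⟨Ω, -, hΓΩ, hΔΩ⟩
    exact hΓΩ.trans hΔΩ.symm
  · rintro ⟨T, P, Q, h⟩
    obtain ⟨hs, hb⟩ := NormalFormData.eq_of_localAction hd hd' T P Q h
    exact ⟨hs, T, hb⟩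
  · rintro ⟨⟨hbase, hsteps⟩, T, hne, hperm⟩
    obtain ⟨c⟩ := hd.nonempty_coords
    have hT : T.val 0 0 ≠ 0 ∨ T.val 0 1 ≠ 0 := by
      by_contra! h0
      refine ((Matrix.isUnit_iff_isUnit_det _).1 T.isUnit).ne_zero ?_
      rw [Matrix.det_fin_two, h0.1, h0.2]
      ring
    -- The absence of poles at the eigenvalues is exactly what keeps the first matrix surjective
    -- after T, so the transformed pair again has a normal form.
    have hsurj := c.surjective_of_isUnit _ _ hT (isUnit_smul_one_add_jordanMatrix d.blocks _ _ hne)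
    rw [← toLin'_localAction_one_one T.val Ω 0] at hsurj
    obtain ⟨d₁, Ω₁, P, Q, hd₁, hΩ₁⟩ := exists_represents hsurj
    rw [localAction_mul, Matrix.one_mul, Matrix.mul_one, Matrix.one_mul] at hΩ₁
    -- The necessary conditions, applied to this new form, show that it has the data of `d'` up to
    -- the order of the Jordan blocks.
    obtain ⟨⟨hbase₁, hsteps₁⟩, -, hperm₁⟩ := NormalFormData.eq_of_localAction hd hd₁ T P Q hΩ₁
    have hp : d₁.blocks.Perm d'.blocks := hperm₁.symm.trans hperm
    obtain ⟨σ, hσ⟩ := exists_jordanMatrix_submatrix hp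
    obtain ⟨c₁⟩ := hd₁.nonempty_coords
    obtain ⟨c'⟩ := hd'.nonempty_coords
    have c₂ := c₁.permute hp σ hσ
    rw [← hbase₁, ← hsteps₁, hbase, hsteps] at c₂
    obtain ⟨P', Q', h⟩ := exists_strictEquiv c₂ c'
    have h₁ : SLOCCEquiv Ω Ω₁ := ⟨T, P, Q, hΩ₁⟩
    exact h₁.trans ⟨1, P', Q', h⟩
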